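/- Let $\mathbb S^2\subset\mathbb R^3$ be the unit sphere with the round metric, area element $dM$, and complex structure $J$ given by $JX=x\times X$ for $X\in T_x\mathbb S^2=x^\perp$ (rotation by $+\pi/2$ for the orientation by the outward normal). Let $\phi=(\phi_1,\phi_2,\phi_3):\mathbb S^2\to\mathbb R^3$ be the inclusion map, and for smooth $u:\mathbb S^2\to\mathbb R$ write $\|\nabla u\|_{L^2}=\big(\int_{\mathbb S^2}\|\nabla u\|^2\,dM\big)^{1/2}$. Let $f,h:\mathbb S^2\to\mathbb R$ be smooth. (a) For each $i\in\{1,2,3\}$ the short integral Cauchy–Riemann inequality holds: $$2\int_{\mathbb S^2}\phi_i\,\langle J\nabla f,\nabla h\rangle\,dM\;\le\;\|\nabla f\|_{L^2}\,\|\nabla h\|_{L^2}.\qquad(*)$$ (b) Let $(i,j,k)$ be a positive (i.e. even) permutation of $(1,2,3)$. Equality holds in $(*)$ for the index $i$ if and only if $f$ is constant, or $h$ is constant, or there are constants $c_j,c_k,c,c'\in\mathbb R$ and $r>0$ with $$f=c_j\phi_j+c_k\phi_k+c,\qquad h=r\,(-c_k\phi_j+c_j\phi_k)+c'.$$ (c)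 If $\|\nabla f\|_{L^2}=\|\nabla h\|_{L^2}$, then (b) holds with $r=1$: equality holds in $(*)$ for the index $i$ if and only if $f$ is constant, or $h$ is constant, or there are constants $c_j,c_k,c,c'\in\mathbb R$ with $f=c_j\phi_j+c_k\phi_k+c$ and $h=-c_k\phi_j+c_j\phi_k+c'$. -/

import Mathlib

open MeasureTheory Metric
open scoped Manifold ContDiff Matrix

noncomputable section

namespace CauchyRiemannSphere

/-- Euclidean three-space. -/
abbrev E3 : Type := EuclideanSpace ℝ (Fin 3)

instance fact_finrank_E3 : Fact (Module.finrank ℝ E3 = 2 + 1) := ⟨by simp⟩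

/-- The unit sphere `S²` of `ℝ³`, a smooth manifold modelled on `ℝ²`. -/
abbrev S2 : Type := sphere (0 : E3) 1

/-- The tangent plane of `S²` at `x`, realised as the plane `x^⊥` of `ℝ³`, with the inner product
inherited from `ℝ³`; this is the round metric. -/
abbrev TangentPlane (x : S2) : Submodule ℝ E3 := (Submodule.span ℝ {(x : E3)})ᗮ

/-- The identification of the manifold tangent space of `S²` at `x` with the plane `x^⊥`, by the
differential of the inclusion of `S²` in `ℝ³`. -/
def tangentEquiv (x : S2) : TangentSpace (𝓡 2) x ≃ₗ[ℝ] TangentPlane x :=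
  (LinearEquiv.ofInjective
      (mvfderiv (𝓡 2) ((↑) : S2 → E3) x : TangentSpace (𝓡 2) x →ₗ[ℝ] E3)
      (injective_mvfderiv_subtypeVal_sphere x)).trans
    (LinearEquiv.ofEq _ _ (range_mvfderiv_subtypeVal x))

theorem tangentEquiv_apply (x : S2) (v : TangentSpace (𝓡 2) x) :
    (tangentEquiv x v : E3) = mvfderiv (𝓡 2) ((↑) : S2 → E3) x v := rfl

/-- The gradient of `f` on `S²` at `x`: the tangent vector that represents the differential of
`f` at `x` in the round metric. -/
def grad (f : S2 → ℝ) (x : S2) : TangentPlane x :=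
  (InnerProductSpace.toDual ℝ (TangentPlane x)).symm
    (LinearMap.toContinuousLinearMap
      ((mvfderiv (𝓡 2) f x : TangentSpace (𝓡 2) x →ₗ[ℝ] ℝ) ∘ₗ
        ((tangentEquiv x).symm : TangentPlane x →ₗ[ℝ] TangentSpace (𝓡 2) x)))

/-- The defining property of the gradient. -/
theorem inner_grad (f : S2 → ℝ) (x : S2) (v : TangentSpace (𝓡 2) x) :
    inner ℝ (grad f x) (tangentEquiv x v) = mvfderiv (𝓡 2) f x v := by
  simp [grad]

/-- The complex structure of `S²` (oriented by the outward normal): `J v = x × v` for `v` tangent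
at `x`, the rotation of the tangent plane by a positive right angle. -/
def J (x : S2) (v : TangentPlane x) : TangentPlane x :=
  ⟨WithLp.toLp 2 ((x : E3).ofLp ⨯₃ (v : E3).ofLp), by
    rw [Submodule.mem_orthogonal_singleton_iff_inner_right, EuclideanSpace.inner_eq_star_dotProduct]
    simp [dotProduct_comm]⟩

/-- The Riemannian area measure of `S²`. -/
def area : Measure S2 := (volume : Measure E3).toSphere

/-- The coordinate functions of the inclusion `φ = (φ₁, φ₂, φ₃) : S² → ℝ³`
(indexed by `0, 1, 2`). -/
def coord (i : Fin 3) (x : S2) : ℝ := (x : E3) i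

/-- `∫ φᵢ ⟨J∇f, ∇h⟩` over `S²`. -/
def crIntegral (i : Fin 3) (f h : S2 → ℝ) : ℝ :=
  ∫ x, coord i x * inner ℝ (J x (grad f x)) (grad h x) ∂area

/-- The `L²` norm of `∇f` on `S²`. -/
def gradL2 (f : S2 → ℝ) : ℝ := √(∫ x, ‖grad f x‖ ^ 2 ∂area)

/-- The function `f` is constant. -/
def IsConst (f : S2 → ℝ) : Prop := ∃ c : ℝ, ∀ x, f x = c

/-- `(i, j, k)` is a positive (that is, even) permutation of the three indices. -/
def IsPositivePerm (i j k : Fin 3) : Prop :=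
  ∃ σ : Equiv.Perm (Fin 3), Equiv.Perm.sign σ = 1 ∧ σ 0 = i ∧ σ 1 = j ∧ σ 2 = k

end CauchyRiemannSphere

end

noncomputable section

namespace CauchyRiemannSphere

/-! Write L_i, L_j, L_k for the derivatives along the rotations about the three axes, with (i, j, k)
a positive permutation; in the code these are `rotDeriv j k`, `rotDeriv k i`, `rotDeriv i j`,
applied to extensions that are constant on rays. On the sphere ‖∇f‖² = (L_i f)² + (L_j f)² + (L_k
f)², and φ_i⟨J∇f, ∇h⟩ = L_j f L_k h − L_k f L_j h. Since rotations preserve area, each L integrates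
to zero, and the commutation relation turns the integral of this Jacobian into ∫ f L_i h.

Using each expression for half of 4∫φ_i⟨J∇f, ∇h⟩ gives the identity on which everything rests: ‖∇f‖²
+ ‖∇h‖² − 4∫φ_i⟨J∇f, ∇h⟩ (norms in L²) is the integral of (L_j f − L_k h)² + (L_k f + L_j h)² plus
the integral of (L_i f)² + (L_i h)² − 2 f L_i h. The first is a sum of squares. The second is an
average over the circles about the axis i, and on each circle it is nonnegative by the analytic
isoperimetric inequality, that is, by Wirtinger. Multiplying f by ‖∇h‖ and h by ‖∇f‖ changes the sum
of energies into a product of norms.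

In the case of equality f and h satisfy the first-order system L_j f = L_k h, L_k f = −L_j h, and
L_i h is f minus its mean on every circle. Hence L_i L_i h = L_i f, and the symmetry (f, h) ↦ (h,
−f) adds L_i L_i f = −L_i h. So G = L_i h and K = −L_i f solve the first-order equations satisfied
by the pair (φ_j, φ_k), and the complex quotient (G + √−1 K)/(φ_j + √−1 φ_k) is constant off the
axis. This determines L_i f and L_i h; subtracting the matching linear functions leaves a pair
invariant under rotation about the axis that solves the same system, hence constants. The two poles
are recovered by continuity. -/

/-- Smoothness on the complement of the origin. -/
def SmoothOffZero (F : E3 → ℝ) : Prop := ∀ y : E3, y ≠ 0 → ContDiffAt ℝ ∞ F y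

/-! ### Radial extension and the gradient. -/

theorem norm_coe_S2 (x : S2) : ‖(x : E3)‖ = 1 := by simp

theorem coe_S2_ne_zero (x : S2) : (x : E3) ≠ 0 := fun h => by
  have := norm_coe_S2 x
  simp [h] at this

/-- The radial projection to the sphere (with an arbitrary value at the origin). -/
def sphereProj (y : E3) : S2 :=
  if h : y = 0 then ⟨EuclideanSpace.single 0 1, by simp⟩
  else ⟨‖y‖⁻¹ • y, by simp [norm_smul, h]⟩

theorem coe_sphereProj {y : E3} (h : y ≠ 0) : (sphereProj y : E3) = ‖y‖⁻¹ • y := by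
  simp [sphereProj, h]

theorem sphereProj_coe (x : S2) : sphereProj (x : E3) = x := by
  ext1
  simp [coe_sphereProj (coe_S2_ne_zero x)]

theorem sphereProj_smul {c : ℝ} (hc : 0 < c) (y : E3) : sphereProj (c • y) = sphereProj y := by
  by_cases h : y = 0
  · simp [h]
  · ext1
    rw [coe_sphereProj h, coe_sphereProj (smul_ne_zero hc.ne' h), norm_smul, smul_smul,
      Real.norm_of_nonneg hc.le]
    congr 1
    field_simp

theorem contMDiffAt_sphereProj {y : E3} (hy : y ≠ 0) :
    ContMDiffAt 𝓘(ℝ, E3) (𝓡 2) ∞ sphereProj y := by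
  let U : TopologicalSpace.Opens E3 := ⟨{0}ᶜ, isOpen_compl_singleton⟩
  have hU (z : U) : (z : E3) ≠ 0 := z.2
  have h1 : ContMDiff 𝓘(ℝ, E3) 𝓘(ℝ, E3) ∞ (fun z : U => ‖(z : E3)‖⁻¹ • (z : E3)) := by
    intro z
    have h2 : ContDiffAt ℝ ∞ (fun w : E3 => ‖w‖⁻¹ • w) (z : E3) :=
      ((contDiffAt_norm ℝ (hU z)).inv (norm_ne_zero_iff.2 (hU z))).smul contDiffAt_id
    exact contMDiffAt_subtype_iff.2 h2.contMDiffAt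
  have h3 := h1.codRestrict_sphere (n := 2) (fun z => by
    simp [norm_smul, hU z])
  have h4 : ContMDiff 𝓘(ℝ, E3) (𝓡 2) ∞ (fun z : U => sphereProj (z : E3)) := by
    have h5 : (fun z : U => sphereProj (z : E3)) = Set.codRestrict _ _ (fun z : U => by
        simp [norm_smul, hU z] : ∀ z : U, ‖(z : E3)‖⁻¹ • (z : E3) ∈ sphere (0 : E3) 1) := by
      funext z
      ext1
      simp [coe_sphereProj (hU z)]
    rw [h5]
    exact h3
  exact contMDiffAt_subtype_iff.1 (h4 ⟨y, hy⟩)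

/-- The extension of a function on the sphere that is constant on open rays from the origin. -/
def radialExt (f : S2 → ℝ) (y : E3) : ℝ := f (sphereProj y)

theorem radialExt_coe (f : S2 → ℝ) (x : S2) : radialExt f x = f x := by
  rw [radialExt, sphereProj_coe]

theorem radialExt_smul (f : S2 → ℝ) {c : ℝ} (hc : 0 < c) (y : E3) :
    radialExt f (c • y) = radialExt f y := by
  rw [radialExt, sphereProj_smul hc, radialExt]

theorem smoothOffZero_radialExt {f : S2 → ℝ} (hf : ContMDiff (𝓡 2) 𝓘(ℝ, ℝ) ∞ f) :
    SmoothOffZero (radialExt f) := fun y hy =>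
  contMDiffAt_iff_contDiffAt.1 ((hf (sphereProj y)).comp y (contMDiffAt_sphereProj hy))

theorem SmoothOffZero.differentiableAt {F : E3 → ℝ} (hF : SmoothOffZero F) {y : E3} (hy : y ≠ 0) :
    DifferentiableAt ℝ F y := (hF y hy).differentiableAt (by simp)

theorem fderiv_eq_zero_of_homogeneous {F : E3 → ℝ} {y : E3} (hF : DifferentiableAt ℝ F y)
    (hom : ∀ c : ℝ, 0 < c → F (c • y) = F y) : fderiv ℝ F y y = 0 := by
  have h1 : HasDerivAt (fun c : ℝ => c • y) y 1 := by
    simpa using (hasDerivAt_id (1 : ℝ)).smul_const y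
  have h2 : HasDerivAt (fun c : ℝ => F (c • y)) (fderiv ℝ F y y) 1 := by
    have h3 : HasFDerivAt F (fderiv ℝ F y) ((1 : ℝ) • y) := by simpa using hF.hasFDerivAt
    exact h3.comp_hasDerivAt (1 : ℝ) h1
  have h4 : HasDerivAt (fun c : ℝ => F (c • y)) 0 1 := by
    refine (hasDerivAt_const (1 : ℝ) (F y)).congr_of_eventuallyEq ?_
    filter_upwards [lt_mem_nhds (zero_lt_one : (0 : ℝ) < 1)] with c hc using hom c hc
  exact h2.unique h4

/-- Tangential directions give the defining property of the gradient; the radial direction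
contributes zero on both sides, by homogeneity on the left and tangency of the gradient on the
right. -/
theorem fderiv_radialExt {f : S2 → ℝ} (hf : ContMDiff (𝓡 2) 𝓘(ℝ, ℝ) ∞ f) (x : S2) (v : E3) :
    fderiv ℝ (radialExt f) x v = inner ℝ (grad f x : E3) v := by
  have hF := (smoothOffZero_radialExt hf).differentiableAt (coe_S2_ne_zero x)
  have key (w : TangentPlane x) : fderiv ℝ (radialExt f) x w = inner ℝ (grad f x : E3) (w : E3) := by
    obtain ⟨u, rfl⟩ := (tangentEquiv x).surjective w
    have h1 := inner_grad f x u
    rw [Submodule.coe_inner] at h1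
    rw [h1, tangentEquiv_apply]
    have h2 : f = radialExt f ∘ ((↑) : S2 → E3) := by
      funext z
      simp [radialExt_coe]
    have h3 : MDifferentiableAt (𝓡 2) 𝓘(ℝ, E3) ((↑) : S2 → E3) x :=
      (contMDiff_coe_sphere (n := 2) (m := 1) x).mdifferentiableAt (by simp)
    have h4 := mvfderiv_comp_apply (I := 𝓘(ℝ, E3)) (I' := 𝓡 2) x
      (f := ((↑) : S2 → E3)) (g := radialExt f) hF.mdifferentiableAt h3 u
    conv_rhs => rw [h2]
    have h5 : mvfderiv 𝓘(ℝ, E3) (radialExt f) (x : E3) = fderiv ℝ (radialExt f) x :=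
      mfderiv_eq_fderiv
    rw [h4, h5]
    rfl
  have hx : inner ℝ (x : E3) (x : E3) = 1 := by
    rw [real_inner_self_eq_norm_sq, norm_coe_S2]; norm_num
  have hw : v - inner ℝ (x : E3) v • (x : E3) ∈ TangentPlane x := by
    rw [Submodule.mem_orthogonal_singleton_iff_inner_right, inner_sub_right, inner_smul_right, hx]
    ring
  have h5 := key ⟨_, hw⟩
  have h6 : fderiv ℝ (radialExt f) x x = 0 :=
    fderiv_eq_zero_of_homogeneous hF fun c hc => radialExt_smul f hc _
  have h7 : inner ℝ (grad f x : E3) (x : E3) = 0 :=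
    Submodule.mem_orthogonal_singleton_iff_inner_left.1 (grad f x).2
  simpa [inner_sub_right, inner_smul_right, h6, h7] using h5

/-! ### Rotation derivatives and their algebra. -/

/-- The velocity field of the rotations in the plane of the axes `a` and `b`. -/
def rotField (a b : Fin 3) (y : E3) : E3 :=
  y a • EuclideanSpace.single b 1 - y b • EuclideanSpace.single a 1

/-- The derivative along the rotations in the plane of the axes `a` and `b`. -/
def rotDeriv (a b : Fin 3) (F : E3 → ℝ) (y : E3) : ℝ := fderiv ℝ F y (rotField a b y)

theorem rotDeriv_apply (a b : Fin 3) (F : E3 → ℝ) (y : E3) :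
    rotDeriv a b F y = y a * fderiv ℝ F y (EuclideanSpace.single b 1)
      - y b * fderiv ℝ F y (EuclideanSpace.single a 1) := by
  simp [rotDeriv, rotField]

theorem rotDeriv_swap (a b : Fin 3) (F : E3 → ℝ) (y : E3) :
    rotDeriv b a F y = -rotDeriv a b F y := by
  simp only [rotDeriv_apply]; ring

theorem rotDeriv_cyclic (i j k : Fin 3) (F : E3 → ℝ) (y : E3) :
    y i * rotDeriv j k F y + y j * rotDeriv k i F y + y k * rotDeriv i j F y = 0 := by
  simp only [rotDeriv_apply]; ring

theorem rotDeriv_radialExt {f : S2 → ℝ} (hf : ContMDiff (𝓡 2) 𝓘(ℝ, ℝ) ∞ f) (a b : Fin 3) (x : S2) :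
    rotDeriv a b (radialExt f) x
      = (x : E3) a * (grad f x : E3) b - (x : E3) b * (grad f x : E3) a := by
  simp [rotDeriv_apply, fderiv_radialExt hf, EuclideanSpace.inner_single_right]

theorem smoothOffZero_coordinate (a : Fin 3) : SmoothOffZero (fun y => y a) := fun _ _ => by
  fun_prop

theorem SmoothOffZero.add {F G : E3 → ℝ} (hF : SmoothOffZero F) (hG : SmoothOffZero G) :
    SmoothOffZero (fun y => F y + G y) := fun y hy => (hF y hy).add (hG y hy)

theorem SmoothOffZero.sub {F G : E3 → ℝ} (hF : SmoothOffZero F) (hG : SmoothOffZero G) :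
    SmoothOffZero (fun y => F y - G y) := fun y hy => (hF y hy).sub (hG y hy)

theorem SmoothOffZero.mul {F G : E3 → ℝ} (hF : SmoothOffZero F) (hG : SmoothOffZero G) :
    SmoothOffZero (fun y => F y * G y) := fun y hy => (hF y hy).mul (hG y hy)

theorem SmoothOffZero.neg {F : E3 → ℝ} (hF : SmoothOffZero F) :
    SmoothOffZero (fun y => -F y) := fun y hy => (hF y hy).neg

theorem SmoothOffZero.fderiv_apply {F : E3 → ℝ} (hF : SmoothOffZero F) (v : E3) :
    SmoothOffZero (fun y => fderiv ℝ F y v) := fun y hy =>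
  ((hF y hy).fderiv_right (m := ∞) (by simp)).clm_apply contDiffAt_const

theorem SmoothOffZero.rotDeriv {F : E3 → ℝ} (hF : SmoothOffZero F) (a b : Fin 3) :
    SmoothOffZero (rotDeriv a b F) := by
  have : CauchyRiemannSphere.rotDeriv a b F = _ := funext (rotDeriv_apply a b F)
  rw [this]
  exact ((smoothOffZero_coordinate a).mul (hF.fderiv_apply _)).sub
    ((smoothOffZero_coordinate b).mul (hF.fderiv_apply _))

theorem rotDeriv_mul {F G : E3 → ℝ} {y : E3} (hF : DifferentiableAt ℝ F y)
    (hG : DifferentiableAt ℝ G y) (a b : Fin 3) :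
    rotDeriv a b (fun z => F z * G z) y = rotDeriv a b F y * G y + F y * rotDeriv a b G y := by
  simp only [rotDeriv, fderiv_fun_mul hF hG, add_apply, smul_apply, smul_eq_mul]
  ring

theorem rotDeriv_add {F G : E3 → ℝ} {y : E3} (hF : DifferentiableAt ℝ F y)
    (hG : DifferentiableAt ℝ G y) (a b : Fin 3) :
    rotDeriv a b (fun z => F z + G z) y = rotDeriv a b F y + rotDeriv a b G y := by
  simp [rotDeriv, fderiv_fun_add hF hG]

theorem rotDeriv_sub {F G : E3 → ℝ} {y : E3} (hF : DifferentiableAt ℝ F y)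
    (hG : DifferentiableAt ℝ G y) (a b : Fin 3) :
    rotDeriv a b (fun z => F z - G z) y = rotDeriv a b F y - rotDeriv a b G y := by
  simp [rotDeriv, fderiv_fun_sub hF hG]

theorem rotDeriv_neg (F : E3 → ℝ) (y : E3) (a b : Fin 3) :
    rotDeriv a b (fun z => -F z) y = -rotDeriv a b F y := by
  simp [rotDeriv, fderiv_fun_neg]

theorem rotDeriv_coordinate (a b c : Fin 3) (y : E3) :
    rotDeriv a b (fun z => z c) y
      = y a * (if c = b then 1 else 0) - y b * (if c = a then 1 else 0) := by
  have : fderiv ℝ (fun z : E3 => z c) y = EuclideanSpace.proj c :=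
    (EuclideanSpace.proj c : E3 →L[ℝ] ℝ).fderiv
  simp [rotDeriv_apply, this]

/-- The commutation relation of the rotation fields. -/
theorem rotDeriv_comm {F : E3 → ℝ} (hF : SmoothOffZero F) {y : E3} (hy : y ≠ 0) {a b c : Fin 3}
    (hab : a ≠ b) (hbc : b ≠ c) (hac : a ≠ c) :
    rotDeriv a b (rotDeriv b c F) y - rotDeriv b c (rotDeriv a b F) y = rotDeriv a c F y := by
  have hD (v : E3) := (hF.fderiv_apply v).differentiableAt hy
  have hX (c : Fin 3) := (smoothOffZero_coordinate c).differentiableAt hy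
  -- Second derivatives commute, so only the first-order terms of the commutator survive.
  have hsymm (v w : E3) : fderiv ℝ (fun z => fderiv ℝ F z v) y w
      = fderiv ℝ (fun z => fderiv ℝ F z w) y v := by
    have h1 : DifferentiableAt ℝ (fderiv ℝ F) y :=
      ((hF y hy).fderiv_right (m := ∞) (by simp)).differentiableAt (by simp)
    have h2 : IsSymmSndFDerivAt ℝ F y := (hF y hy).isSymmSndFDerivAt
      (by simp only [minSmoothness_of_isRCLikeNormedField]; exact ENat.LEInfty.out)
    rw [fderiv_clm_apply h1 (by fun_prop), fderiv_clm_apply h1 (by fun_prop)]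
    simpa using h2 w v
  have hM (c : Fin 3) (v : E3) := (hX c).mul (hD v)
  simp only [Pi.mul_def] at hM
  have h1 (a b : Fin 3) : rotDeriv a b F = fun y => y a * fderiv ℝ F y (EuclideanSpace.single b 1)
      - y b * fderiv ℝ F y (EuclideanSpace.single a 1) := funext (rotDeriv_apply a b F)
  rw [h1 b c, h1 a b]
  rw [rotDeriv_sub (hM b _) (hM c _), rotDeriv_sub (hM a _) (hM b _),
    rotDeriv_mul (hX _) (hD _), rotDeriv_mul (hX _) (hD _), rotDeriv_mul (hX _) (hD _),
    rotDeriv_mul (hX _) (hD _)]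
  simp only [rotDeriv_coordinate, hab, hab.symm, hbc, hbc.symm, hac, hac.symm, if_true, if_false]
  simp only [rotDeriv_apply]
  rw [hsymm (EuclideanSpace.single c 1) (EuclideanSpace.single b 1),
    hsymm (EuclideanSpace.single c 1) (EuclideanSpace.single a 1),
    hsymm (EuclideanSpace.single b 1) (EuclideanSpace.single a 1)]
  ring

theorem IsPositivePerm.cases {i j k : Fin 3} (h : IsPositivePerm i j k) :
    (i = 0 ∧ j = 1 ∧ k = 2) ∨ (i = 1 ∧ j = 2 ∧ k = 0) ∨ (i = 2 ∧ j = 0 ∧ k = 1) := by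
  obtain ⟨σ, hσ, rfl, rfl, rfl⟩ := h
  revert σ
  decide

theorem exists_isPositivePerm (i : Fin 3) : ∃ j k, IsPositivePerm i j k := by
  unfold IsPositivePerm
  revert i
  decide

/-- The three rotation derivatives are the components of x × ∇f, and x is a unit vector orthogonal
to ∇f. -/
theorem norm_grad_sq {f : S2 → ℝ} (hf : ContMDiff (𝓡 2) 𝓘(ℝ, ℝ) ∞ f) {i j k : Fin 3}
    (h : IsPositivePerm i j k) (x : S2) :
    ‖grad f x‖ ^ 2 = rotDeriv j k (radialExt f) x ^ 2 + rotDeriv k i (radialExt f) x ^ 2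
      + rotDeriv i j (radialExt f) x ^ 2 := by
  have h1 : inner ℝ (x : E3) (grad f x : E3) = 0 :=
    Submodule.mem_orthogonal_singleton_iff_inner_right.1 (grad f x).2
  have h2 := EuclideanSpace.real_norm_sq_eq (x : E3)
  rw [norm_coe_S2, Fin.sum_univ_three] at h2
  have h3 : ‖grad f x‖ ^ 2 = ‖(grad f x : E3)‖ ^ 2 := rfl
  rw [h3, EuclideanSpace.real_norm_sq_eq, Fin.sum_univ_three]
  simp only [rotDeriv_radialExt hf]
  simp only [PiLp.inner_apply, Fin.sum_univ_three, RCLike.inner_apply, conj_trivial] at h1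
  generalize (grad f x : E3) = g at *
  obtain ⟨rfl, rfl, rfl⟩ | ⟨rfl, rfl, rfl⟩ | ⟨rfl, rfl, rfl⟩ := h.cases <;>
  linear_combination (g 0 ^ 2 + g 1 ^ 2 + g 2 ^ 2) * h2
    + (g 0 * (x : E3) 0 + g 1 * (x : E3) 1 + g 2 * (x : E3) 2) * h1

/-- This is the i-th component of the vector identity (x × a) × (x × b) = det(x, a, b) x with a =
∇f, b = ∇g. -/
theorem coord_mul_inner_J {f g : S2 → ℝ} (hf : ContMDiff (𝓡 2) 𝓘(ℝ, ℝ) ∞ f)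
    (hg : ContMDiff (𝓡 2) 𝓘(ℝ, ℝ) ∞ g) {i j k : Fin 3} (h : IsPositivePerm i j k) (x : S2) :
    coord i x * inner ℝ (J x (grad f x)) (grad g x)
      = rotDeriv k i (radialExt f) x * rotDeriv i j (radialExt g) x
        - rotDeriv i j (radialExt f) x * rotDeriv k i (radialExt g) x := by
  rw [Submodule.coe_inner]
  simp only [rotDeriv_radialExt hf, rotDeriv_radialExt hg, PiLp.inner_apply, Fin.sum_univ_three,
    RCLike.inner_apply, conj_trivial, J, coord, crossProduct]
  obtain ⟨rfl, rfl, rfl⟩ | ⟨rfl, rfl, rfl⟩ | ⟨rfl, rfl, rfl⟩ := h.cases <;> simp <;> ring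

/-! ### Wirtinger's inequality on a circle. -/

/-- The mean value of a function over one period `2π`. -/
def circleMean (u : ℝ → ℝ) : ℝ := (2 * Real.pi)⁻¹ * ∫ t in (0)..(2 * Real.pi), u t

theorem integral_sub_circleMean {u : ℝ → ℝ} (hu : Continuous u) :
    ∫ t in (0)..(2 * Real.pi), (u t - circleMean u) = 0 := by
  rw [intervalIntegral.integral_sub (hu.intervalIntegrable _ _) intervalIntegrable_const,
    intervalIntegral.integral_const, circleMean, smul_eq_mul]
  have := Real.pi_pos
  field_simp
  ring

theorem memLp_ofReal {g : ℝ → ℝ} (hg : Continuous g) {a b : ℝ} :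
    MemLp (fun t => (g t : ℂ)) 2 (volume.restrict (Set.Ioc a b)) := by
  have h : Continuous (fun t => (g t : ℂ)) := Complex.continuous_ofReal.comp hg
  have h1 : IsFiniteMeasure (volume.restrict (Set.Ioc a b)) := ⟨by simp⟩
  obtain ⟨C, hC⟩ := (isCompact_Icc (a := a) (b := b)).exists_bound_of_continuousOn h.continuousOn
  refine MemLp.of_bound h.aestronglyMeasurable C ?_
  filter_upwards [ae_restrict_mem measurableSet_Ioc] with t ht using hC t (Set.Ioc_subset_Icc_self ht)

/-- **Wirtinger's inequality** for functions of mean zero. -/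
theorem wirtinger {u u' : ℝ → ℝ} (hu : ∀ t, HasDerivAt u (u' t) t) (hc : Continuous u')
    (hper : u (2 * Real.pi) = u 0) (h0 : ∫ t in (0)..(2 * Real.pi), u t = 0) :
    ∫ t in (0)..(2 * Real.pi), u t ^ 2 ≤ ∫ t in (0)..(2 * Real.pi), u' t ^ 2 := by
  have hpi : (0 : ℝ) < 2 * Real.pi := by positivity
  have huc : Continuous u := continuous_iff_continuousAt.2 fun t => (hu t).continuousAt
  have h1 := hasSum_sq_fourierCoeffOn hpi (memLp_ofReal huc)
  have h2 := hasSum_sq_fourierCoeffOn hpi (memLp_ofReal hc)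
  have h3 : ∀ n : ℤ, ‖fourierCoeffOn hpi (fun t => (u t : ℂ)) n‖ ^ 2
      ≤ ‖fourierCoeffOn hpi (fun t => (u' t : ℂ)) n‖ ^ 2 := by
    intro n
    gcongr
    rcases eq_or_ne n 0 with rfl | hn
    · have : fourierCoeffOn hpi (fun t => (u t : ℂ)) 0 = 0 := by
        rw [fourierCoeffOn_eq_integral]
        simp [intervalIntegral.integral_ofReal, h0]
      rw [this]
      simp
    -- By periodicity the boundary term vanishes: the n-th coefficient of u is, up to a unit factor,
    -- that of u' divided by n, and |n| ≥ 1.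
    · rw [fourierCoeffOn_of_hasDerivAt hpi hn (fun t _ => (hu t).ofReal_comp)
        ((Complex.continuous_ofReal.comp hc).intervalIntegrable _ _)]
      have hn1 : (1 : ℝ) ≤ |(n : ℝ)| := by exact_mod_cast Int.one_le_abs hn
      simp only [hper, sub_self, mul_zero, zero_sub, Complex.ofReal_zero, sub_zero,
        norm_mul, norm_neg, norm_div,
        norm_one, Complex.norm_real, Complex.norm_I, Complex.norm_intCast, Complex.norm_ofNat,
        Complex.ofReal_mul, Complex.ofReal_ofNat, Real.norm_of_nonneg Real.pi_pos.le]
      rw [← mul_assoc]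
      refine mul_le_of_le_one_left (norm_nonneg _) ?_
      have := Real.pi_pos
      have hn2 : 0 < |(n : ℝ)| := by linarith
      field_simp
      exact hn1
  have h4 := hasSum_le h3 h1 h2
  simp only [Complex.norm_real, Real.norm_eq_abs, sq_abs, sub_zero, smul_eq_mul] at h4
  exact le_of_mul_le_mul_left h4 (by positivity)

/-- The isoperimetric inequality for closed curves, with the deficit bounded below by a
square. -/
theorem circle_deficit {u v u' v' : ℝ → ℝ} (hu : ∀ t, HasDerivAt u (u' t) t)
    (hv : ∀ t, HasDerivAt v (v' t) t) (huc : Continuous u') (hvc : Continuous v')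
    (hup : u (2 * Real.pi) = u 0) (hvp : v (2 * Real.pi) = v 0) :
    ∫ t in (0)..(2 * Real.pi), (u t - circleMean u - v' t) ^ 2
      ≤ ∫ t in (0)..(2 * Real.pi), (u' t ^ 2 + v' t ^ 2 - 2 * (u t * v' t)) := by
  have hc : Continuous u := continuous_iff_continuousAt.2 fun t => (hu t).continuousAt
  have hv0 : ∫ t in (0)..(2 * Real.pi), v' t = 0 := by
    rw [intervalIntegral.integral_eq_sub_of_hasDerivAt (fun t _ => hv t)
      (hvc.intervalIntegrable _ _), hvp, sub_self]
  have h1 := wirtinger (u := fun t => u t - circleMean u) (u' := u')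
    (fun t => (hu t).sub_const _) huc (by simp [hup]) (integral_sub_circleMean hc)
  have hI {g : ℝ → ℝ} (hg : Continuous g) :
      IntervalIntegrable g volume 0 (2 * Real.pi) := hg.intervalIntegrable _ _
  -- Completing the square around the mean of u; the last term vanishes because v is periodic, and
  -- the two middle terms are compared by Wirtinger.
  have h2 : ∫ t in (0)..(2 * Real.pi), (u' t ^ 2 + v' t ^ 2 - 2 * (u t * v' t))
      = (∫ t in (0)..(2 * Real.pi), (u t - circleMean u - v' t) ^ 2)
        + (∫ t in (0)..(2 * Real.pi), u' t ^ 2)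
        - (∫ t in (0)..(2 * Real.pi), (u t - circleMean u) ^ 2)
        - 2 * circleMean u * ∫ t in (0)..(2 * Real.pi), v' t := by
    rw [← intervalIntegral.integral_const_mul, ← intervalIntegral.integral_add (hI (by fun_prop))
      (hI (by fun_prop)), ← intervalIntegral.integral_sub (hI (by fun_prop)) (hI (by fun_prop)),
      ← intervalIntegral.integral_sub (hI (by fun_prop)) (hI (by fun_prop))]
    congr 1
    funext t
    ring
  rw [h2, hv0]
  linarith

theorem circle_inequality {u v u' v' : ℝ → ℝ} (hu : ∀ t, HasDerivAt u (u' t) t)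
    (hv : ∀ t, HasDerivAt v (v' t) t) (huc : Continuous u') (hvc : Continuous v')
    (hup : u (2 * Real.pi) = u 0) (hvp : v (2 * Real.pi) = v 0) :
    0 ≤ ∫ t in (0)..(2 * Real.pi), (u' t ^ 2 + v' t ^ 2 - 2 * (u t * v' t)) :=
  (intervalIntegral.integral_nonneg (by positivity) fun t _ => sq_nonneg _).trans
    (circle_deficit hu hv huc hvc hup hvp)

theorem circle_equality {u v u' v' : ℝ → ℝ} (hu : ∀ t, HasDerivAt u (u' t) t)
    (hv : ∀ t, HasDerivAt v (v' t) t) (huc : Continuous u') (hvc : Continuous v')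
    (hup : u (2 * Real.pi) = u 0) (hvp : v (2 * Real.pi) = v 0)
    (h0 : ∫ t in (0)..(2 * Real.pi), (u' t ^ 2 + v' t ^ 2 - 2 * (u t * v' t)) = 0) :
    ∀ t ∈ Set.Icc 0 (2 * Real.pi), v' t = u t - circleMean u := by
  have hc : Continuous u := continuous_iff_continuousAt.2 fun t => (hu t).continuousAt
  have hpi : (0 : ℝ) < 2 * Real.pi := by positivity
  have h1 := circle_deficit hu hv huc hvc hup hvp
  rw [h0] at h1
  by_contra! hne
  obtain ⟨t, ht, hne⟩ := hne
  have h2 : 0 < ∫ t in (0)..(2 * Real.pi), (u t - circleMean u - v' t) ^ 2 := by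
    refine intervalIntegral.integral_pos hpi (by fun_prop) (fun _ _ => sq_nonneg _) ⟨t, ht, ?_⟩
    exact sq_pos_of_ne_zero (sub_ne_zero.2 hne.symm)
  linarith

/-! ### Invariance of area under rotations, and integration by parts. -/

instance : IsFiniteMeasure area := by unfold area; infer_instance

instance : area.IsOpenPosMeasure := by unfold area; infer_instance

theorem integrable_area {g : S2 → ℝ} (hg : Continuous g) : Integrable g area :=
  hg.integrable_of_hasCompactSupport (HasCompactSupport.of_compactSpace g)

-- The area of a set is a multiple of the volume of the cone over it, and linear isometries map
-- cones to cones and preserve volume.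
open scoped Pointwise in
theorem measurePreserving_sphere (A : E3 ≃ₗᵢ[ℝ] E3) :
    MeasurePreserving (fun x : S2 => (⟨A x, by simp⟩ : S2)) area area := by
  have hm : Measurable (fun x : S2 => (⟨A x, by simp⟩ : S2)) :=
    ((A.continuous.comp continuous_subtype_val).subtype_mk _).measurable
  refine ⟨hm, Measure.ext fun s hs => ?_⟩
  rw [Measure.map_apply hm hs, area, Measure.toSphere_apply' _ (hm hs), Measure.toSphere_apply' _ hs,
    ← A.measurePreserving.measure_preimage_emb A.toHomeomorph.measurableEmbedding
      (Set.Ioo (0 : ℝ) 1 • ((↑) '' s : Set E3))]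
  congr 2
  ext y
  simp only [Set.mem_smul, Set.mem_image, Set.mem_preimage]
  constructor
  · rintro ⟨r, hr, -, ⟨x, hx, rfl⟩, rfl⟩
    exact ⟨r, hr, _, ⟨_, hx, rfl⟩, by simp⟩
  · rintro ⟨r, hr, -, ⟨x, hx, rfl⟩, h⟩
    refine ⟨r, hr, A.symm x, ⟨⟨A.symm x, by simp⟩, by simpa using hx, rfl⟩, ?_⟩
    apply A.injective
    simpa using h

/-- The rotation by the angle `t` in the plane of the axes `a` and `b`. -/
def rotMap (a b : Fin 3) (t : ℝ) (y : E3) : E3 :=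
  y + (Real.cos t - 1) • (y a • EuclideanSpace.single a 1 + y b • EuclideanSpace.single b 1)
    + Real.sin t • rotField a b y

theorem rotMap_zero (a b : Fin 3) (y : E3) : rotMap a b 0 y = y := by simp [rotMap]

theorem rotMap_two_pi (a b : Fin 3) (y : E3) : rotMap a b (2 * Real.pi) y = y := by simp [rotMap]

theorem rotMap_apply_left {a b : Fin 3} (hab : a ≠ b) (t : ℝ) (y : E3) :
    rotMap a b t y a = Real.cos t * y a - Real.sin t * y b := by
  simp [rotMap, rotField, hab]
  ring

theorem rotMap_apply_right {a b : Fin 3} (hab : a ≠ b) (t : ℝ) (y : E3) :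
    rotMap a b t y b = Real.cos t * y b + Real.sin t * y a := by
  simp [rotMap, rotField, hab.symm]
  ring

theorem rotMap_apply_of_ne {a b c : Fin 3} (ha : c ≠ a) (hb : c ≠ b) (t : ℝ) (y : E3) :
    rotMap a b t y c = y c := by
  simp [rotMap, rotField, ha, hb]

theorem norm_rotMap {a b : Fin 3} (hab : a ≠ b) (t : ℝ) (y : E3) : ‖rotMap a b t y‖ = ‖y‖ := by
  obtain ⟨c, ha, hb⟩ : ∃ c : Fin 3, c ≠ a ∧ c ≠ b := by
    revert a b; decide
  have hs (z : E3) : ‖z‖ ^ 2 = z a ^ 2 + z b ^ 2 + z c ^ 2 := by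
    rw [EuclideanSpace.real_norm_sq_eq]
    have h : (Finset.univ : Finset (Fin 3)) = {a, b, c} := by
      revert a b c; decide
    rw [h, Finset.sum_insert (by simp [hab, ha.symm]), Finset.sum_insert (by simp [hb.symm]),
      Finset.sum_singleton]
    ring
  rw [← sq_eq_sq₀ (norm_nonneg _) (norm_nonneg _), hs, hs, rotMap_apply_left hab,
    rotMap_apply_right hab, rotMap_apply_of_ne ha hb]
  linear_combination (y a ^ 2 + y b ^ 2) * Real.sin_sq_add_cos_sq t

/-- Rotations as linear isometries. -/
def rotIsometry {a b : Fin 3} (hab : a ≠ b) (t : ℝ) : E3 ≃ₗᵢ[ℝ] E3 :=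
  LinearIsometry.toLinearIsometryEquiv
    { toFun := rotMap a b t
      map_add' := fun y z => by
        simp only [rotMap, rotField, PiLp.add_apply]
        module
      map_smul' := fun c y => by
        simp only [rotMap, rotField, PiLp.smul_apply, smul_eq_mul, RingHom.id_apply]
        module
      norm_map' := norm_rotMap hab t } rfl

/-- The rotations of the sphere. -/
def rotSphere {a b : Fin 3} (hab : a ≠ b) (t : ℝ) (x : S2) : S2 :=
  ⟨rotMap a b t x, by simp [norm_rotMap hab]⟩

theorem coe_rotSphere {a b : Fin 3} (hab : a ≠ b) (t : ℝ) (x : S2) :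
    (rotSphere hab t x : E3) = rotMap a b t x := rfl

theorem measurePreserving_rotSphere {a b : Fin 3} (hab : a ≠ b) (t : ℝ) :
    MeasurePreserving (rotSphere hab t) area area :=
  measurePreserving_sphere (rotIsometry hab t)

theorem continuous_rotSphere {a b : Fin 3} (hab : a ≠ b) :
    Continuous (fun p : S2 × ℝ => rotSphere hab p.2 p.1) := by
  refine Continuous.subtype_mk ?_ _
  simp only [rotMap, rotField]
  fun_prop

theorem hasDerivAt_rotMap {a b : Fin 3} (hab : a ≠ b) (t : ℝ) (y : E3) :
    HasDerivAt (fun s => rotMap a b s y) (rotField a b (rotMap a b t y)) t := by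
  have h1 : HasDerivAt (fun s => rotMap a b s y)
      ((-Real.sin t) • (y a • EuclideanSpace.single a 1 + y b • EuclideanSpace.single b 1)
        + Real.cos t • rotField a b y) t :=
    ((((Real.hasDerivAt_cos t).sub_const 1).smul_const _).const_add y).add
      ((Real.hasDerivAt_sin t).smul_const _)
  convert h1 using 1
  rw [rotField, rotMap_apply_left hab, rotMap_apply_right hab, rotField]
  module

theorem hasDerivAt_comp_rotSphere {a b : Fin 3} (hab : a ≠ b) {F : E3 → ℝ} (hF : SmoothOffZero F)
    (x : S2) (t : ℝ) :
    HasDerivAt (fun s => F (rotSphere hab s x)) (rotDeriv a b F (rotSphere hab t x)) t :=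
  ((hF.differentiableAt (coe_S2_ne_zero _)).hasFDerivAt).comp_hasDerivAt t
    (hasDerivAt_rotMap hab t x)

theorem SmoothOffZero.continuous {F : E3 → ℝ} (hF : SmoothOffZero F) :
    Continuous (fun x : S2 => F x) :=
  continuous_iff_continuousAt.2 fun x =>
    (hF x (coe_S2_ne_zero x)).continuousAt.comp continuous_subtype_val.continuousAt

theorem continuous_comp_rotSphere {a b : Fin 3} (hab : a ≠ b) {g : S2 → ℝ} (hg : Continuous g)
    (x : S2) : Continuous (fun t => g (rotSphere hab t x)) :=
  hg.comp ((continuous_rotSphere hab).comp (Continuous.prodMk_right x))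

/-- Averaging over the circles of a rotation. -/
theorem integral_circle {a b : Fin 3} (hab : a ≠ b) {g : S2 → ℝ} (hg : Continuous g) :
    ∫ x, (∫ t in (0)..(2 * Real.pi), g (rotSphere hab t x)) ∂area
      = 2 * Real.pi * ∫ x, g x ∂area := by
  have hpi : (0 : ℝ) ≤ 2 * Real.pi := by positivity
  have hc : Continuous (fun p : S2 × ℝ => g (rotSphere hab p.2 p.1)) :=
    hg.comp (continuous_rotSphere hab)
  obtain ⟨C, hC⟩ := isCompact_univ.exists_bound_of_continuousOn hg.continuousOn
  have hfin : IsFiniteMeasure (volume.restrict (Set.Ioc 0 (2 * Real.pi))) := ⟨by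
    rw [Measure.restrict_apply_univ]; exact measure_Ioc_lt_top⟩
  have hI : Integrable (fun p : S2 × ℝ => g (rotSphere hab p.2 p.1))
      (area.prod (volume.restrict (Set.Ioc 0 (2 * Real.pi)))) :=
    Integrable.of_bound hc.aestronglyMeasurable C (ae_of_all _ fun p => hC _ (Set.mem_univ _))
  simp only [intervalIntegral.integral_of_le hpi]
  rw [integral_integral_swap hI]
  have h (t : ℝ) : ∫ x, g (rotSphere hab t x) ∂area = ∫ x, g x ∂area := by
    conv_rhs => rw [← (measurePreserving_rotSphere hab t).map_eq]
    rw [integral_map (measurePreserving_rotSphere hab t).measurable.aemeasurable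
      hg.aestronglyMeasurable]
  simp only [h]
  simp [Real.pi_pos.le]

/-- Along each circle the integrand is the derivative of a periodic function, so its average over
the circles vanishes. -/
theorem integral_rotDeriv {a b : Fin 3} (hab : a ≠ b) {F : E3 → ℝ} (hF : SmoothOffZero F) :
    ∫ x : S2, rotDeriv a b F x ∂area = 0 := by
  have h1 := integral_circle hab (hF.rotDeriv a b).continuous
  have h2 (x : S2) : ∫ t in (0)..(2 * Real.pi), rotDeriv a b F (rotSphere hab t x) = 0 := by
    rw [intervalIntegral.integral_eq_sub_of_hasDerivAt
      (fun t _ => hasDerivAt_comp_rotSphere hab hF x t)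
      ((continuous_comp_rotSphere hab (hF.rotDeriv a b).continuous x).intervalIntegrable _ _)]
    simp only [coe_rotSphere, rotMap_two_pi, rotMap_zero, sub_self]
  simp only [h2, integral_zero] at h1
  have := Real.pi_pos
  simpa [this.ne'] using h1.symm

theorem IsPositivePerm.ne {i j k : Fin 3} (h : IsPositivePerm i j k) : i ≠ j ∧ j ≠ k ∧ k ≠ i := by
  obtain ⟨rfl, rfl, rfl⟩ | ⟨rfl, rfl, rfl⟩ | ⟨rfl, rfl, rfl⟩ := h.cases <;> decide

/-- Integration by parts for the Jacobian of two functions. -/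
theorem integral_jacobian {F H : E3 → ℝ} (hF : SmoothOffZero F) (hH : SmoothOffZero H)
    {i j k : Fin 3} (h : IsPositivePerm i j k) :
    ∫ x : S2, (rotDeriv k i F x * rotDeriv i j H x - rotDeriv i j F x * rotDeriv k i H x) ∂area
      = ∫ x : S2, F x * rotDeriv j k H x ∂area := by
  obtain ⟨hij, hjk, hki⟩ := h.ne
  have hd {G : E3 → ℝ} (hG : SmoothOffZero G) (x : S2) : DifferentiableAt ℝ G x :=
    hG.differentiableAt (coe_S2_ne_zero x)
  -- With h2: the integrals of L_j(F L_k H) and L_k(F L_j H) vanish. Their difference is the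
  -- Jacobian plus F times the commutator [L_j, L_k]H = −L_i H.
  have h1 := integral_rotDeriv hki (hF.mul (hH.rotDeriv i j))
  have h2 := integral_rotDeriv hij (hF.mul (hH.rotDeriv k i))
  have hc1 := ((hF.mul (hH.rotDeriv i j)).rotDeriv k i).continuous
  have hc2 := ((hF.mul (hH.rotDeriv k i)).rotDeriv i j).continuous
  have hc3 := (hF.mul (hH.rotDeriv j k)).continuous
  rw [← sub_eq_zero, ← integral_sub (integrable_area
    (((hF.rotDeriv k i).mul (hH.rotDeriv i j)).sub
      ((hF.rotDeriv i j).mul (hH.rotDeriv k i))).continuous) (integrable_area hc3)]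
  have h5 := integral_sub (integrable_area hc1) (integrable_area hc2)
  rw [h1, h2, sub_zero] at h5
  rw [← h5]
  refine integral_congr_ae (ae_of_all _ fun x => ?_)
  have h3 := rotDeriv_comm hH (coe_S2_ne_zero x) hki hij hjk.symm
  have h4 := rotDeriv_swap j k H x
  simp only [rotDeriv_mul (hd hF x) (hd (hH.rotDeriv _ _) x)]
  linear_combination -F x * h3 - F x * h4

/-! ### Functions whose rotation derivatives vanish. -/

theorem eq_zero_of_integral_eq_zero {g : S2 → ℝ} (hg : Continuous g) (h0 : ∀ x, 0 ≤ g x)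
    (hi : ∫ x, g x ∂area = 0) (x : S2) : g x = 0 := by
  have h1 := (integral_eq_zero_iff_of_nonneg h0 (integrable_area hg)).1 hi
  exact congrFun ((hg.ae_eq_iff_eq area continuous_const).1 h1) x

/-- The derivatives along rotations at points of the sphere depend only on the values on the
sphere. -/
theorem rotDeriv_congr {F G : E3 → ℝ} (hFG : ∀ x : S2, F x = G x) {x : S2}
    (hF : DifferentiableAt ℝ F x) (hG : DifferentiableAt ℝ G x) {a b : Fin 3} (hab : a ≠ b) :
    rotDeriv a b F x = rotDeriv a b G x := by
  -- A rotation orbit stays on the sphere, so this derivative sees only values taken there.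
  have key {K : E3 → ℝ} (hK : DifferentiableAt ℝ K x) :
      HasDerivAt (fun s => K (rotSphere hab s x)) (rotDeriv a b K x) 0 := by
    have h1 := hasDerivAt_rotMap hab 0 (x : E3)
    rw [rotMap_zero] at h1
    have h2 : HasFDerivAt K (fderiv ℝ K x) (rotMap a b 0 (x : E3)) := by
      rw [rotMap_zero]; exact hK.hasFDerivAt
    exact h2.comp_hasDerivAt 0 h1
  refine (key hF).unique ?_
  simp only [hFG]
  exact key hG

theorem norm_sq_S2 (x : S2) {i j k : Fin 3} (h : IsPositivePerm i j k) :
    (x : E3) i ^ 2 + (x : E3) j ^ 2 + (x : E3) k ^ 2 = 1 := by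
  have h2 := EuclideanSpace.real_norm_sq_eq (x : E3)
  rw [norm_coe_S2, Fin.sum_univ_three] at h2
  obtain ⟨rfl, rfl, rfl⟩ | ⟨rfl, rfl, rfl⟩ | ⟨rfl, rfl, rfl⟩ := h.cases <;> linarith

/-- If l is the derivative as a vector, the hypotheses say x · l = 0 and x × l = 0 with |x| = 1,
which forces l = 0. -/
theorem fderiv_eq_zero_of_rotDeriv {M : E3 → ℝ} {x : S2} {i j k : Fin 3}
    (h : IsPositivePerm i j k) (hr : fderiv ℝ M x x = 0) (hi : rotDeriv j k M x = 0)
    (hj : rotDeriv k i M x = 0) (hk : rotDeriv i j M x = 0) : fderiv ℝ M x = 0 := by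
  have h1 := norm_sq_S2 x h
  simp only [rotDeriv_apply] at hi hj hk
  generalize fderiv ℝ M x = l at *
  have hx (v : E3) : l v = v i * l (EuclideanSpace.single i 1) + v j * l (EuclideanSpace.single j 1)
      + v k * l (EuclideanSpace.single k 1) := by
    have hv : v = v i • EuclideanSpace.single i (1 : ℝ) + v j • EuclideanSpace.single j (1 : ℝ)
        + v k • EuclideanSpace.single k (1 : ℝ) := by
      ext c
      obtain ⟨rfl, rfl, rfl⟩ | ⟨rfl, rfl, rfl⟩ | ⟨rfl, rfl, rfl⟩ := h.cases <;>
      fin_cases c <;> simp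
    conv_lhs => rw [hv]
    simp
  rw [hx] at hr
  ext v
  rw [hx]
  have hi0 : l (EuclideanSpace.single i 1) = 0 := by
    linear_combination -l (EuclideanSpace.single i 1) * h1 + (x : E3) i * hr
      + (x : E3) k * hj - (x : E3) j * hk
  have hj0 : l (EuclideanSpace.single j 1) = 0 := by
    linear_combination -l (EuclideanSpace.single j 1) * h1 + (x : E3) j * hr
      + (x : E3) i * hk - (x : E3) k * hi
  have hk0 : l (EuclideanSpace.single k 1) = 0 := by
    linear_combination -l (EuclideanSpace.single k 1) * h1 + (x : E3) k * hr
      + (x : E3) j * hi - (x : E3) i * hj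
  simp [hi0, hj0, hk0]

/-- The set is the complement of a line in ℝ³, a subspace of codimension two. -/
theorem isConnected_off_axis {i j k : Fin 3} (h : IsPositivePerm i j k) :
    IsConnected {y : E3 | y j ^ 2 + y k ^ 2 ≠ 0} := by
  have h1 : {y : E3 | y j ^ 2 + y k ^ 2 ≠ 0}
      = ((Submodule.span ℝ {EuclideanSpace.single i (1 : ℝ)} : Submodule ℝ E3) : Set E3)ᶜ := by
    ext y
    simp only [Set.mem_ofPred_eq, Set.mem_compl_iff, SetLike.mem_coe,
      Submodule.mem_span_singleton, ne_eq, not_iff_not]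
    constructor
    · intro hy
      have hj : y j = 0 := by nlinarith [sq_nonneg (y j), sq_nonneg (y k)]
      have hk : y k = 0 := by nlinarith [sq_nonneg (y j), sq_nonneg (y k)]
      refine ⟨y i, ?_⟩
      ext c
      obtain ⟨rfl, rfl, rfl⟩ | ⟨rfl, rfl, rfl⟩ | ⟨rfl, rfl, rfl⟩ := h.cases <;>
      fin_cases c <;> simp [hj, hk]
    · rintro ⟨c, rfl⟩
      obtain ⟨hij, hjk, hki⟩ := h.ne
      simp [hij.symm, hki]
  rw [h1]
  refine isConnected_compl_of_one_lt_codim ?_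
  rw [← Module.finrank_eq_rank]
  have h2 := Submodule.finrank_quotient_add_finrank
    (Submodule.span ℝ {EuclideanSpace.single i (1 : ℝ)} : Submodule ℝ E3)
  rw [finrank_span_singleton (by simp), finrank_euclideanSpace_fin] at h2
  have h3 : Module.finrank ℝ (E3 ⧸ Submodule.span ℝ {EuclideanSpace.single i (1 : ℝ)}) = 2 := by
    omega
  rw [h3]
  norm_num

/-- A function whose derivatives along all rotations vanish off an axis is constant off the
axis. -/
theorem exists_const_off_axis {N : E3 → ℝ} {i j k : Fin 3} (h : IsPositivePerm i j k)
    (hd : ∀ x : S2, (x : E3) j ^ 2 + (x : E3) k ^ 2 ≠ 0 → DifferentiableAt ℝ N x)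
    (hi : ∀ x : S2, (x : E3) j ^ 2 + (x : E3) k ^ 2 ≠ 0 → rotDeriv j k N x = 0)
    (hj : ∀ x : S2, (x : E3) j ^ 2 + (x : E3) k ^ 2 ≠ 0 → rotDeriv k i N x = 0)
    (hk : ∀ x : S2, (x : E3) j ^ 2 + (x : E3) k ^ 2 ≠ 0 → rotDeriv i j N x = 0) :
    ∃ c : ℝ, ∀ x : S2, (x : E3) j ^ 2 + (x : E3) k ^ 2 ≠ 0 → N x = c := by
  obtain ⟨hij, hjk, hki⟩ := h.ne
  set U : Set E3 := {y : E3 | y j ^ 2 + y k ^ 2 ≠ 0} with hU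
  have hUo : IsOpen U := isOpen_ne_fun (by fun_prop) (by fun_prop)
  have hU0 : ∀ y ∈ U, y ≠ 0 := by
    rintro y hy rfl
    simp [hU] at hy
  have hUs (c : ℝ) (hc : 0 < c) (y : E3) (hy : y ∈ U) : c • y ∈ U := by
    have h1 : (c • y) j ^ 2 + (c • y) k ^ 2 = c ^ 2 * (y j ^ 2 + y k ^ 2) := by
      simp only [PiLp.smul_apply, smul_eq_mul]; ring
    rw [hU, Set.mem_ofPred_eq, h1]
    exact mul_ne_zero (by positivity) hy
  -- Nothing is assumed about the radial behaviour of N. Its ray-constant replacement has the same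
  -- rotation derivatives on the sphere and no radial derivative, so its full derivative vanishes on
  -- the connected cone U.
  let M := radialExt (fun x : S2 => N x)
  have hMN (x : S2) : M x = N x := radialExt_coe _ x
  have hM : ∀ y ∈ U, DifferentiableAt ℝ M y := by
    intro y hy
    have h1 : DifferentiableAt ℝ (fun z : E3 => N (‖z‖⁻¹ • z)) y := by
      have h2 : DifferentiableAt ℝ N (‖y‖⁻¹ • y) := by
        have h3 := hUs ‖y‖⁻¹ (inv_pos.2 (norm_pos_iff.2 (hU0 y hy))) y hy
        rw [← coe_sphereProj (hU0 y hy)] at h3 ⊢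
        exact hd _ h3
      have h4 : DifferentiableAt ℝ (fun z : E3 => ‖z‖⁻¹ • z) y :=
        ((differentiableAt_id.norm ℝ (hU0 y hy)).inv (norm_ne_zero_iff.2 (hU0 y hy))).smul
          differentiableAt_id
      exact DifferentiableAt.comp (g := N) (f := fun z : E3 => ‖z‖⁻¹ • z) y h2 h4
    refine h1.congr_of_eventuallyEq ?_
    filter_upwards [hUo.mem_nhds hy] with z hz
    simp only [M, radialExt, coe_sphereProj (hU0 z hz)]
  have hM0 : ∀ y ∈ U, fderiv ℝ M y = 0 := by
    intro y hy
    have hy0 := hU0 y hy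
    have hc : 0 < ‖y‖⁻¹ := inv_pos.2 (norm_pos_iff.2 hy0)
    have hxU : (sphereProj y : E3) ∈ U := by
      rw [coe_sphereProj hy0]
      exact hUs _ hc y hy
    have h1 : fderiv ℝ M (sphereProj y) = 0 := by
      have hdM := hM _ hxU
      refine fderiv_eq_zero_of_rotDeriv h (fderiv_eq_zero_of_homogeneous hdM fun c hc =>
        radialExt_smul _ hc _) ?_ ?_ ?_
      · rw [rotDeriv_congr hMN hdM (hd _ hxU) hjk, hi _ hxU]
      · rw [rotDeriv_congr hMN hdM (hd _ hxU) hki, hj _ hxU]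
      · rw [rotDeriv_congr hMN hdM (hd _ hxU) hij, hk _ hxU]
    have h2 : M = fun z => M (‖y‖⁻¹ • z) := funext fun z => (radialExt_smul _ hc z).symm
    rw [h2, fderiv_comp_smul, ← coe_sphereProj hy0, h1, smul_zero]
  obtain ⟨c, hc⟩ := hUo.exists_is_const_of_fderiv_eq_zero (isConnected_off_axis h).isPreconnected
    (fun y hy => (hM y hy).differentiableWithinAt) hM0
  exact ⟨c, fun x hx => by rw [← hMN, hc x hx]⟩

/-- The complement of an axis is dense in the sphere. -/
theorem eq_of_eq_off_axis {f g : S2 → ℝ} (hf : Continuous f) (hg : Continuous g) {i j k : Fin 3}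
    (h : IsPositivePerm i j k)
    (hfg : ∀ x : S2, (x : E3) j ^ 2 + (x : E3) k ^ 2 ≠ 0 → f x = g x) (x : S2) : f x = g x := by
  obtain ⟨hij, hjk, hki⟩ := h.ne
  by_cases hx : (x : E3) j ^ 2 + (x : E3) k ^ 2 = 0
  · have h1 := norm_sq_S2 x h
    have hxj : (x : E3) j = 0 := by nlinarith [sq_nonneg ((x : E3) j), sq_nonneg ((x : E3) k)]
    have hxi : (x : E3) i ≠ 0 := by
      intro h0
      rw [h0] at h1
      linarith
    -- A pole is approached along its orbit under a rotation that moves the axis; for angles in (0,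
    -- π) the orbit is off the axis.
    have h2 : Set.EqOn (fun t => f (rotSphere hij t x)) (fun t => g (rotSphere hij t x))
        (Set.Ioo 0 Real.pi) := by
      intro t ht
      refine hfg _ ?_
      rw [coe_rotSphere, rotMap_apply_right hij, hxj]
      have h3 : 0 < (Real.sin t * (x : E3) i) ^ 2 :=
        sq_pos_of_ne_zero (mul_ne_zero (Real.sin_pos_of_pos_of_lt_pi ht.1 ht.2).ne' hxi)
      have := sq_nonneg (rotMap i j t x k)
      rw [mul_zero, zero_add]
      exact (add_pos_of_pos_of_nonneg h3 this).ne'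
    have h3 := h2.closure (continuous_comp_rotSphere hij hf x) (continuous_comp_rotSphere hij hg x)
    rw [closure_Ioo Real.pi_pos.ne] at h3
    have h4 := h3 (Set.left_mem_Icc.2 Real.pi_pos.le)
    have h5 : rotSphere hij 0 x = x := Subtype.ext (rotMap_zero i j x)
    simpa only [h5] using h4
  · exact hfg x hx

theorem isConst_of_rotDeriv_eq_zero {f : S2 → ℝ} (hf : ContMDiff (𝓡 2) 𝓘(ℝ, ℝ) ∞ f)
    {i j k : Fin 3} (h : IsPositivePerm i j k) (hi : ∀ x : S2, rotDeriv j k (radialExt f) x = 0)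
    (hj : ∀ x : S2, rotDeriv k i (radialExt f) x = 0)
    (hk : ∀ x : S2, rotDeriv i j (radialExt f) x = 0) : IsConst f := by
  obtain ⟨c, hc⟩ := exists_const_off_axis h
    (fun x _ => (smoothOffZero_radialExt hf).differentiableAt (coe_S2_ne_zero x))
    (fun x _ => hi x) (fun x _ => hj x) (fun x _ => hk x)
  refine ⟨c, eq_of_eq_off_axis hf.continuous continuous_const h fun x hx => ?_⟩
  rw [← hc x hx, radialExt_coe]

/-! ### Conjugate pairs. -/

/-- The quotient of conjugate functions by the conjugate coordinates is constant. -/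
theorem exists_const_quotient {G K : E3 → ℝ} (hG : SmoothOffZero G) (hK : SmoothOffZero K)
    {i j k : Fin 3} (h : IsPositivePerm i j k) (h1 : ∀ x : S2, rotDeriv j k G x = -K x)
    (h2 : ∀ x : S2, rotDeriv j k K x = G x)
    (h3 : ∀ x : S2, rotDeriv k i G x = rotDeriv i j K x)
    (h4 : ∀ x : S2, rotDeriv i j G x = -rotDeriv k i K x) :
    ∃ c : ℝ, ∀ x : S2, (x : E3) j ^ 2 + (x : E3) k ^ 2 ≠ 0 →
      G x * (x : E3) j + K x * (x : E3) k = c * ((x : E3) j ^ 2 + (x : E3) k ^ 2) := by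
  obtain ⟨hij, hjk, hki⟩ := h.ne
  let A : E3 → ℝ := fun y => G y * y j + K y * y k
  let B : E3 → ℝ := fun y => y j * y j + y k * y k
  have hX := smoothOffZero_coordinate
  have hA : SmoothOffZero A := (hG.mul (hX j)).add (hK.mul (hX k))
  have hB : SmoothOffZero B := ((hX j).mul (hX j)).add ((hX k).mul (hX k))
  have hd {L : E3 → ℝ} (hL : SmoothOffZero L) (x : S2) : DifferentiableAt ℝ L x :=
    hL.differentiableAt (coe_S2_ne_zero x)
  have hBne (x : S2) (hx : (x : E3) j ^ 2 + (x : E3) k ^ 2 ≠ 0) : B x ≠ 0 := by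
    simpa only [B, ← sq] using hx
  have hN (x : S2) (hx : (x : E3) j ^ 2 + (x : E3) k ^ 2 ≠ 0) :
      DifferentiableAt ℝ (fun y => A y / B y) x := by
    simp only [div_eq_mul_inv]
    exact (hd hA x).mul ((hd hB x).inv (hBne x hx))
  have hL (a b : Fin 3) (x : S2) (hx : (x : E3) j ^ 2 + (x : E3) k ^ 2 ≠ 0)
      (he : rotDeriv a b A x * B x - A x * rotDeriv a b B x = 0) :
      rotDeriv a b (fun y => A y / B y) x = 0 := by
    have hb := hBne x hx
    have h5 := rotDeriv_mul (hN x hx) (hd hB x) a b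
    -- The quotient rule is obtained from the product rule for (A / B) · B, which equals A near x.
    have h6 : rotDeriv a b (fun y => A y / B y * B y) x = rotDeriv a b A x := by
      have hev : (fun y => A y / B y * B y) =ᶠ[nhds (x : E3)] A := by
        filter_upwards [(hd hB x).continuousAt.eventually_ne hb] with y hy
        exact div_mul_cancel₀ _ hy
      rw [rotDeriv, hev.fderiv_eq, rotDeriv]
    rw [h6] at h5
    have h7 : rotDeriv a b (fun y => A y / B y) x * B x ^ 2 = 0 := by
      field_simp at h5
      linear_combination he - h5
    exact (mul_eq_zero.1 h7).resolve_right (pow_ne_zero 2 hb)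
  have hAL (a b : Fin 3) (x : S2) : rotDeriv a b A x = rotDeriv a b G x * (x : E3) j
      + G x * rotDeriv a b (fun y => y j) x + (rotDeriv a b K x * (x : E3) k
      + K x * rotDeriv a b (fun y => y k) x) := by
    rw [rotDeriv_add (hd (hG.mul (hX j)) x) (hd (hK.mul (hX k)) x),
      rotDeriv_mul (hd hG x) (hd (hX j) x), rotDeriv_mul (hd hK x) (hd (hX k) x)]
  have hBL (a b : Fin 3) (x : S2) : rotDeriv a b B x
      = 2 * (x : E3) j * rotDeriv a b (fun y => y j) x
      + 2 * (x : E3) k * rotDeriv a b (fun y => y k) x := by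
    rw [rotDeriv_add (hd ((hX j).mul (hX j)) x) (hd ((hX k).mul (hX k)) x),
      rotDeriv_mul (hd (hX j) x) (hd (hX j) x), rotDeriv_mul (hd (hX k) x) (hd (hX k) x)]
    ring
  -- A / B is the real part of (G + √−1 K)/(y_j + √−1 y_k). The relation y_i L_i + y_j L_j + y_k L_k
  -- = 0, applied to G and K, gives two linear equations for L_j G and L_k G with determinant ±(y_j²
  -- + y_k²); they fix all derivatives off the axis, and y_j, y_k satisfy the same equations.
  obtain ⟨c, hc⟩ := exists_const_off_axis h hN
    (fun x hx => hL j k x hx (by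
      simp only [hAL, hBL, rotDeriv_coordinate, hjk, hjk.symm, if_true, if_false, h1, h2]
      ring))
    (fun x hx => hL k i x hx (by
      have e1 := rotDeriv_cyclic i j k G x
      have e2 := rotDeriv_cyclic i j k K x
      simp only [hAL, hBL, rotDeriv_coordinate, hjk, hki, hij.symm, if_true, if_false]
      rw [h1, h4] at e1
      rw [h2, ← h3] at e2
      rw [h3]
      rw [h3] at e1 e2
      simp only [A, B]
      linear_combination ((x : E3) j ^ 2 - (x : E3) k ^ 2) * e1
        + 2 * (x : E3) k * (x : E3) j * e2))
    (fun x hx => hL i j x hx (by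
      have e1 := rotDeriv_cyclic i j k G x
      have e2 := rotDeriv_cyclic i j k K x
      simp only [hAL, hBL, rotDeriv_coordinate, hki, hij.symm, hjk.symm, if_true, if_false]
      rw [h1, h4] at e1
      rw [h2, ← h3] at e2
      rw [h4]
      rw [h3] at e1 e2
      simp only [A, B]
      linear_combination 2 * (x : E3) j * (x : E3) k * e1
        + ((x : E3) k ^ 2 - (x : E3) j ^ 2) * e2))
  refine ⟨c, fun x hx => ?_⟩
  have h5 := (div_eq_iff (hBne x hx)).1 (hc x hx)
  simp only [A, B, ← sq] at h5
  exact h5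

/-- Conjugate functions that are invariant under rotations about an axis are constant. -/
theorem exists_const_of_conjugate {F H : E3 → ℝ} (hF : SmoothOffZero F) {i j k : Fin 3}
    (h : IsPositivePerm i j k)
    (h1 : ∀ x : S2, (x : E3) j ^ 2 + (x : E3) k ^ 2 ≠ 0 → rotDeriv j k F x = 0)
    (h2 : ∀ x : S2, (x : E3) j ^ 2 + (x : E3) k ^ 2 ≠ 0 → rotDeriv j k H x = 0)
    (h3 : ∀ x : S2, rotDeriv k i F x = rotDeriv i j H x)
    (h4 : ∀ x : S2, rotDeriv i j F x = -rotDeriv k i H x) :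
    ∃ c : ℝ, ∀ x : S2, (x : E3) j ^ 2 + (x : E3) k ^ 2 ≠ 0 → F x = c := by
  refine exists_const_off_axis h (fun x _ => hF.differentiableAt (coe_S2_ne_zero x)) h1
    (fun x hx => ?_) (fun x hx => ?_)
  -- The same two linear equations, now with zero right-hand side, have only the zero solution off
  -- the axis.
  all_goals
    have e1 := rotDeriv_cyclic i j k F x
    have e2 := rotDeriv_cyclic i j k H x
    rw [h1 x hx, h3, h4] at e1
    rw [h2 x hx] at e2
    first | rw [h3] | rw [h4]
    refine (mul_eq_zero.1 ?_).resolve_left hx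
  · linear_combination (x : E3) j * e1 + (x : E3) k * e2
  · linear_combination (x : E3) k * e1 - (x : E3) j * e2

/-! ### Energy, scaling and constant functions. -/

/-- The Dirichlet energy. -/
def energy (f : S2 → ℝ) : ℝ := ∫ x, ‖grad f x‖ ^ 2 ∂area

theorem energy_nonneg (f : S2 → ℝ) : 0 ≤ energy f := integral_nonneg fun _ => sq_nonneg _

theorem gradL2_sq (f : S2 → ℝ) : gradL2 f ^ 2 = energy f := Real.sq_sqrt (energy_nonneg f)

theorem gradL2_nonneg (f : S2 → ℝ) : 0 ≤ gradL2 f := Real.sqrt_nonneg _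

theorem rotDeriv_const_mul (c : ℝ) (F : E3 → ℝ) (a b : Fin 3) (y : E3) :
    rotDeriv a b (fun z => c * F z) y = c * rotDeriv a b F y := by
  have h1 : fderiv ℝ (c • F) = c • fderiv ℝ F := fderiv_const_smul_field c
  have h2 : (fun z => c * F z) = c • F := rfl
  rw [rotDeriv, rotDeriv, h2, h1]
  rfl

theorem rotDeriv_radialExt_const_mul (c : ℝ) (f : S2 → ℝ) (a b : Fin 3) (y : E3) :
    rotDeriv a b (radialExt fun x => c * f x) y = c * rotDeriv a b (radialExt f) y :=
  rotDeriv_const_mul c (radialExt f) a b y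

theorem contMDiff_const_mul (c : ℝ) {f : S2 → ℝ} (hf : ContMDiff (𝓡 2) 𝓘(ℝ, ℝ) ∞ f) :
    ContMDiff (𝓡 2) 𝓘(ℝ, ℝ) ∞ (fun x => c * f x) :=
  (contDiff_const.mul contDiff_id : ContDiff ℝ ∞ (fun t : ℝ => c * t)).contMDiff.comp hf

theorem energy_const_mul (c : ℝ) {f : S2 → ℝ} (hf : ContMDiff (𝓡 2) 𝓘(ℝ, ℝ) ∞ f) :
    energy (fun x => c * f x) = c ^ 2 * energy f := by
  obtain ⟨j, k, hp⟩ := exists_isPositivePerm 0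
  rw [energy, energy, ← integral_const_mul]
  congr 1
  funext x
  simp only [norm_grad_sq (contMDiff_const_mul c hf) hp, norm_grad_sq hf hp,
    rotDeriv_radialExt_const_mul]
  ring

theorem gradL2_const_mul {c : ℝ} (hc : 0 ≤ c) {f : S2 → ℝ}
    (hf : ContMDiff (𝓡 2) 𝓘(ℝ, ℝ) ∞ f) : gradL2 (fun x => c * f x) = c * gradL2 f := by
  have h1 : gradL2 (fun x => c * f x) = √(energy (fun x => c * f x)) := rfl
  rw [h1, energy_const_mul c hf, Real.sqrt_mul (sq_nonneg c), Real.sqrt_sq hc]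
  rfl

theorem crIntegral_const_mul (c d : ℝ) {f h : S2 → ℝ} (hf : ContMDiff (𝓡 2) 𝓘(ℝ, ℝ) ∞ f)
    (hh : ContMDiff (𝓡 2) 𝓘(ℝ, ℝ) ∞ h) (i : Fin 3) :
    crIntegral i (fun x => c * f x) (fun x => d * h x) = c * d * crIntegral i f h := by
  obtain ⟨j, k, hp⟩ := exists_isPositivePerm i
  rw [crIntegral, crIntegral, ← integral_const_mul]
  congr 1
  funext x
  simp only [coord_mul_inner_J (contMDiff_const_mul c hf) (contMDiff_const_mul d hh) hp,
    coord_mul_inner_J hf hh hp, rotDeriv_radialExt_const_mul]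
  ring

theorem crIntegral_swap {f h : S2 → ℝ} (hf : ContMDiff (𝓡 2) 𝓘(ℝ, ℝ) ∞ f)
    (hh : ContMDiff (𝓡 2) 𝓘(ℝ, ℝ) ∞ h) (i : Fin 3) :
    crIntegral i h f = -crIntegral i f h := by
  obtain ⟨j, k, hp⟩ := exists_isPositivePerm i
  rw [crIntegral, crIntegral, ← integral_neg]
  congr 1
  funext x
  rw [coord_mul_inner_J hf hh hp, coord_mul_inner_J hh hf hp]
  ring

theorem energy_eq_zero_of_isConst {f : S2 → ℝ} (hf : ContMDiff (𝓡 2) 𝓘(ℝ, ℝ) ∞ f)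
    (hc : IsConst f) : energy f = 0 := by
  obtain ⟨c, hc⟩ := hc
  obtain ⟨j, k, hp⟩ := exists_isPositivePerm 0
  have h1 : radialExt f = fun _ => c := funext fun y => hc _
  rw [energy]
  simp only [norm_grad_sq hf hp, h1, rotDeriv, fderiv_fun_const]
  simp

theorem rotDeriv_eq_zero_of_energy_eq_zero {f : S2 → ℝ} (hf : ContMDiff (𝓡 2) 𝓘(ℝ, ℝ) ∞ f)
    (h0 : energy f = 0) {i j k : Fin 3} (hp : IsPositivePerm i j k) (x : S2) :
    rotDeriv j k (radialExt f) x = 0 ∧ rotDeriv k i (radialExt f) x = 0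
      ∧ rotDeriv i j (radialExt f) x = 0 := by
  have hF := smoothOffZero_radialExt hf
  have hc1 := (hF.rotDeriv j k).continuous
  have hc2 := (hF.rotDeriv k i).continuous
  have hc3 := (hF.rotDeriv i j).continuous
  simp only [energy, norm_grad_sq hf hp] at h0
  have h1 := eq_zero_of_integral_eq_zero (by fun_prop) (fun x => by positivity) h0 x
  refine ⟨?_, ?_, ?_⟩ <;> nlinarith [sq_nonneg (rotDeriv j k (radialExt f) x),
    sq_nonneg (rotDeriv k i (radialExt f) x), sq_nonneg (rotDeriv i j (radialExt f) x)]

theorem isConst_of_energy_eq_zero {f : S2 → ℝ} (hf : ContMDiff (𝓡 2) 𝓘(ℝ, ℝ) ∞ f)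
    (h0 : energy f = 0) : IsConst f := by
  obtain ⟨j, k, hp⟩ := exists_isPositivePerm 0
  have h1 := rotDeriv_eq_zero_of_energy_eq_zero hf h0 hp
  exact isConst_of_rotDeriv_eq_zero hf hp (fun x => (h1 x).1) (fun x => (h1 x).2.1)
    (fun x => (h1 x).2.2)

theorem crIntegral_eq_zero_of_isConst_left {f h : S2 → ℝ} (hf : ContMDiff (𝓡 2) 𝓘(ℝ, ℝ) ∞ f)
    (hh : ContMDiff (𝓡 2) 𝓘(ℝ, ℝ) ∞ h) (hc : IsConst f) (i : Fin 3) : crIntegral i f h = 0 := by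
  obtain ⟨j, k, hp⟩ := exists_isPositivePerm i
  have h1 := rotDeriv_eq_zero_of_energy_eq_zero hf (energy_eq_zero_of_isConst hf hc) hp
  simp only [crIntegral, coord_mul_inner_J hf hh hp, h1, zero_mul, sub_self, integral_zero]

theorem crIntegral_eq_zero_of_isConst_right {f h : S2 → ℝ} (hf : ContMDiff (𝓡 2) 𝓘(ℝ, ℝ) ∞ f)
    (hh : ContMDiff (𝓡 2) 𝓘(ℝ, ℝ) ∞ h) (hc : IsConst h) (i : Fin 3) : crIntegral i f h = 0 := by
  rw [crIntegral_swap hh hf, crIntegral_eq_zero_of_isConst_left hh hf hc, neg_zero]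

theorem gradL2_eq_zero_iff {f : S2 → ℝ} (hf : ContMDiff (𝓡 2) 𝓘(ℝ, ℝ) ∞ f) :
    gradL2 f = 0 ↔ IsConst f := by
  rw [← sq_eq_zero_iff, gradL2_sq]
  exact ⟨isConst_of_energy_eq_zero hf, energy_eq_zero_of_isConst hf⟩

/-! ### The inequality between the integral and the sum of energies. -/

/-- The energy deficit splits into a pointwise square and a part that is nonnegative on each
circle. -/
theorem energy_add_energy_sub_crIntegral {f h : S2 → ℝ} (hf : ContMDiff (𝓡 2) 𝓘(ℝ, ℝ) ∞ f)
    (hh : ContMDiff (𝓡 2) 𝓘(ℝ, ℝ) ∞ h) {i j k : Fin 3} (hp : IsPositivePerm i j k) :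
    energy f + energy h - 4 * crIntegral i f h
      = (∫ x : S2, ((rotDeriv k i (radialExt f) x - rotDeriv i j (radialExt h) x) ^ 2
          + (rotDeriv i j (radialExt f) x + rotDeriv k i (radialExt h) x) ^ 2) ∂area)
        + ∫ x : S2, (rotDeriv j k (radialExt f) x ^ 2 + rotDeriv j k (radialExt h) x ^ 2
          - 2 * (f x * rotDeriv j k (radialExt h) x)) ∂area := by
  have hF := smoothOffZero_radialExt hf
  have hH := smoothOffZero_radialExt hh
  have hfc := hf.continuous
  have hc1 := (hF.rotDeriv j k).continuous
  have hc2 := (hF.rotDeriv k i).continuous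
  have hc3 := (hF.rotDeriv i j).continuous
  have hd1 := (hH.rotDeriv j k).continuous
  have hd2 := (hH.rotDeriv k i).continuous
  have hd3 := (hH.rotDeriv i j).continuous
  have h1 := integral_jacobian hF hH hp
  simp only [radialExt_coe] at h1
  have hI {g : S2 → ℝ} (hg : Continuous g) : Integrable g area := integrable_area hg
  -- Half of the integral stays a Jacobian, to complete the squares in L_j and L_k; the other half
  -- is integrated by parts, to produce the cross term on the circles.
  have h2 : 4 * crIntegral i f h
      = (∫ x : S2, 2 * (rotDeriv k i (radialExt f) x * rotDeriv i j (radialExt h) x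
          - rotDeriv i j (radialExt f) x * rotDeriv k i (radialExt h) x) ∂area)
        + ∫ x : S2, 2 * (f x * rotDeriv j k (radialExt h) x) ∂area := by
    simp only [integral_const_mul, h1, crIntegral, coord_mul_inner_J hf hh hp]
    ring
  rw [h2]
  simp only [energy, norm_grad_sq hf hp, norm_grad_sq hh hp]
  rw [← integral_add (hI (by fun_prop)) (hI (by fun_prop)),
    ← integral_add (hI (by fun_prop)) (hI (by fun_prop)),
    ← integral_add (hI (by fun_prop)) (hI (by fun_prop)),
    ← integral_sub (hI (by fun_prop)) (hI (by fun_prop))]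
  congr 1
  funext x
  ring

theorem circle_integral_nonneg {f h : S2 → ℝ} (hf : ContMDiff (𝓡 2) 𝓘(ℝ, ℝ) ∞ f)
    (hh : ContMDiff (𝓡 2) 𝓘(ℝ, ℝ) ∞ h) {j k : Fin 3} (hjk : j ≠ k) (x : S2) :
    0 ≤ ∫ t in (0)..(2 * Real.pi), (rotDeriv j k (radialExt f) (rotSphere hjk t x) ^ 2
      + rotDeriv j k (radialExt h) (rotSphere hjk t x) ^ 2
      - 2 * (f (rotSphere hjk t x) * rotDeriv j k (radialExt h) (rotSphere hjk t x))) := by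
  have hF := smoothOffZero_radialExt hf
  have hH := smoothOffZero_radialExt hh
  have h1 := circle_inequality (hasDerivAt_comp_rotSphere hjk hF x)
    (hasDerivAt_comp_rotSphere hjk hH x)
    (continuous_comp_rotSphere hjk (hF.rotDeriv j k).continuous x)
    (continuous_comp_rotSphere hjk (hH.rotDeriv j k).continuous x)
    (by simp only [coe_rotSphere, rotMap_two_pi, rotMap_zero])
    (by simp only [coe_rotSphere, rotMap_two_pi, rotMap_zero])
  simpa only [radialExt_coe] using h1

theorem integral_circle_part_nonneg {f h : S2 → ℝ} (hf : ContMDiff (𝓡 2) 𝓘(ℝ, ℝ) ∞ f)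
    (hh : ContMDiff (𝓡 2) 𝓘(ℝ, ℝ) ∞ h) {j k : Fin 3} (hjk : j ≠ k) :
    0 ≤ ∫ x : S2, (rotDeriv j k (radialExt f) x ^ 2 + rotDeriv j k (radialExt h) x ^ 2
      - 2 * (f x * rotDeriv j k (radialExt h) x)) ∂area := by
  have hc1 := ((smoothOffZero_radialExt hf).rotDeriv j k).continuous
  have hd1 := ((smoothOffZero_radialExt hh).rotDeriv j k).continuous
  have hfc := hf.continuous
  have h1 := integral_circle hjk (g := fun x : S2 => rotDeriv j k (radialExt f) x ^ 2
    + rotDeriv j k (radialExt h) x ^ 2 - 2 * (f x * rotDeriv j k (radialExt h) x)) (by fun_prop)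
  have h2 := h1 ▸ integral_nonneg (fun x => circle_integral_nonneg hf hh hjk x)
  exact nonneg_of_mul_nonneg_right h2 (by positivity)

theorem four_mul_crIntegral_le {f h : S2 → ℝ} (hf : ContMDiff (𝓡 2) 𝓘(ℝ, ℝ) ∞ f)
    (hh : ContMDiff (𝓡 2) 𝓘(ℝ, ℝ) ∞ h) (i : Fin 3) :
    4 * crIntegral i f h ≤ energy f + energy h := by
  obtain ⟨j, k, hp⟩ := exists_isPositivePerm i
  have h1 := energy_add_energy_sub_crIntegral hf hh hp
  have h2 := integral_circle_part_nonneg hf hh hp.ne.2.1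
  have h3 : 0 ≤ ∫ x : S2, ((rotDeriv k i (radialExt f) x - rotDeriv i j (radialExt h) x) ^ 2
      + (rotDeriv i j (radialExt f) x + rotDeriv k i (radialExt h) x) ^ 2) ∂area :=
    integral_nonneg fun x => by positivity
  linarith

/-! ### The case of equality for the sum of energies. -/

/-- The first-order equations satisfied in the case of equality. -/
theorem equations_of_equality {f h : S2 → ℝ} (hf : ContMDiff (𝓡 2) 𝓘(ℝ, ℝ) ∞ f)
    (hh : ContMDiff (𝓡 2) 𝓘(ℝ, ℝ) ∞ h) {i j k : Fin 3} (hp : IsPositivePerm i j k)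
    (he : 4 * crIntegral i f h = energy f + energy h) (x : S2) :
    rotDeriv k i (radialExt f) x = rotDeriv i j (radialExt h) x
      ∧ rotDeriv i j (radialExt f) x = -rotDeriv k i (radialExt h) x
      ∧ rotDeriv j k (rotDeriv j k (radialExt h)) x = rotDeriv j k (radialExt f) x := by
  have hjk := hp.ne.2.1
  have hF := smoothOffZero_radialExt hf
  have hH := smoothOffZero_radialExt hh
  have hfc := hf.continuous
  have hc1 := (hF.rotDeriv j k).continuous
  have hc2 := (hF.rotDeriv k i).continuous
  have hc3 := (hF.rotDeriv i j).continuous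
  have hd1 := (hH.rotDeriv j k).continuous
  have hd2 := (hH.rotDeriv k i).continuous
  have hd3 := (hH.rotDeriv i j).continuous
  have h1 := energy_add_energy_sub_crIntegral hf hh hp
  have h2 := integral_circle_part_nonneg hf hh hp.ne.2.1
  have h3 : 0 ≤ ∫ x : S2, ((rotDeriv k i (radialExt f) x - rotDeriv i j (radialExt h) x) ^ 2
      + (rotDeriv i j (radialExt f) x + rotDeriv k i (radialExt h) x) ^ 2) ∂area :=
    integral_nonneg fun x => by positivity
  have h4 := eq_zero_of_integral_eq_zero (by fun_prop) (fun x => by positivity)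
    (le_antisymm (by linarith) h3) x
  have h5 : ∫ x : S2, (rotDeriv j k (radialExt f) x ^ 2 + rotDeriv j k (radialExt h) x ^ 2
      - 2 * (f x * rotDeriv j k (radialExt h) x)) ∂area = 0 := le_antisymm (by linarith) h2
  let q : S2 → ℝ := fun x => rotDeriv j k (radialExt f) x ^ 2
    + rotDeriv j k (radialExt h) x ^ 2 - 2 * (f x * rotDeriv j k (radialExt h) x)
  have hq : Continuous q := by fun_prop
  have h6 := integral_circle hjk hq
  rw [h5, mul_zero] at h6
  have hqc : Continuous (fun x => ∫ t in (0)..(2 * Real.pi), q (rotSphere hjk t x)) :=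
    intervalIntegral.continuous_parametric_intervalIntegral_of_continuous'
      (f := fun x t => q (rotSphere hjk t x)) (hq.comp (continuous_rotSphere hjk)) _ _
  have h7 := eq_zero_of_integral_eq_zero hqc (circle_integral_nonneg hf hh hjk) h6 x
  have h8 := circle_equality (hasDerivAt_comp_rotSphere hjk hF x)
    (hasDerivAt_comp_rotSphere hjk hH x)
    (continuous_comp_rotSphere hjk (hF.rotDeriv j k).continuous x)
    (continuous_comp_rotSphere hjk (hH.rotDeriv j k).continuous x)
    (by simp only [coe_rotSphere, rotMap_two_pi, rotMap_zero])
    (by simp only [coe_rotSphere, rotMap_two_pi, rotMap_zero])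
    (by simpa only [radialExt_coe] using h7)
  refine ⟨by nlinarith, by nlinarith, ?_⟩
  -- The circle identity is known only on [0, 2π], so it is differentiated at the endpoint 0 within
  -- that interval; this removes the unknown mean.
  have hpi : (0 : ℝ) < 2 * Real.pi := by positivity
  have h9 := (hasDerivAt_comp_rotSphere hjk (hH.rotDeriv j k) x 0).hasDerivWithinAt
    (s := Set.Icc 0 (2 * Real.pi))
  have h10 := ((hasDerivAt_comp_rotSphere hjk hF x 0).sub_const
    (circleMean fun t => radialExt f (rotSphere hjk t x))).hasDerivWithinAt
    (s := Set.Icc 0 (2 * Real.pi))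
  have h11 := (uniqueDiffOn_Icc hpi _ (Set.left_mem_Icc.2 hpi.le)).eq_deriv _ h9
    (h10.congr h8 (h8 0 (Set.left_mem_Icc.2 hpi.le)))
  simpa only [coe_rotSphere, rotMap_zero] using h11

theorem eq_of_equality {f h : S2 → ℝ} (hf : ContMDiff (𝓡 2) 𝓘(ℝ, ℝ) ∞ f)
    (hh : ContMDiff (𝓡 2) 𝓘(ℝ, ℝ) ∞ h) {i j k : Fin 3} (hp : IsPositivePerm i j k)
    (he : 4 * crIntegral i f h = energy f + energy h) :
    ∃ cj ck c c' : ℝ, (∀ x, f x = cj * coord j x + ck * coord k x + c) ∧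
      (∀ x, h x = -ck * coord j x + cj * coord k x + c') := by
  obtain ⟨hij, hjk, hki⟩ := hp.ne
  have hF := smoothOffZero_radialExt hf
  have hH := smoothOffZero_radialExt hh
  have hX := smoothOffZero_coordinate
  have hd {L : E3 → ℝ} (hL : SmoothOffZero L) (x : S2) : DifferentiableAt ℝ L x :=
    hL.differentiableAt (coe_S2_ne_zero x)
  have hneg := contMDiff_const_mul (-1) hf
  -- The pair (h, −f) has the same integral and energies, so it is also a case of equality; its
  -- second-order equation supplies `e4`.
  have he' : 4 * crIntegral i h (fun x => -1 * f x) = energy h + energy (fun x => -1 * f x) := by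
    have h1 := crIntegral_const_mul 1 (-1) hh hf i
    simp only [one_mul] at h1
    rw [h1, crIntegral_swap hf hh, energy_const_mul _ hf]
    linarith
  have e1 (x : S2) := (equations_of_equality hf hh hp he x).1
  have e2 (x : S2) := (equations_of_equality hf hh hp he x).2.1
  have e3 (x : S2) := (equations_of_equality hf hh hp he x).2.2
  have e4 (x : S2) : rotDeriv j k (rotDeriv j k (radialExt f)) x
      = -rotDeriv j k (radialExt h) x := by
    have h1 := (equations_of_equality hh hneg hp he' x).2.2
    have h2 : rotDeriv j k (radialExt fun x => -1 * f x)
        = fun y => -1 * rotDeriv j k (radialExt f) y :=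
      funext (rotDeriv_radialExt_const_mul (-1) f j k)
    rw [h2, rotDeriv_const_mul] at h1
    linarith
  generalize hFe : radialExt f = F at *
  generalize hHe : radialExt h = H at *
  have hFf (x : S2) : F x = f x := by rw [← hFe, radialExt_coe]
  have hHh (x : S2) : H x = h x := by rw [← hHe, radialExt_coe]
  have hG := hH.rotDeriv j k
  have hK := (hF.rotDeriv j k).neg
  -- The first-order equations hold only on the sphere, and L_i is tangent to it, so they may be
  -- differentiated by L_i. The commutators then yield `R1` and `R2`: the pair (L_i h, −L_i f)
  -- solves the same system as (f, h).
  have C1 (x : S2) : rotDeriv j k (rotDeriv k i H) x = -rotDeriv j k (rotDeriv i j F) x := by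
    rw [← rotDeriv_neg]
    refine rotDeriv_congr (fun z => ?_) (hd (hH.rotDeriv k i) x) (hd (hF.rotDeriv i j).neg x) hjk
    linarith [e2 z]
  have C2 (x : S2) : rotDeriv j k (rotDeriv i j H) x = rotDeriv j k (rotDeriv k i F) x :=
    rotDeriv_congr (fun z => (e1 z).symm) (hd (hH.rotDeriv i j) x) (hd (hF.rotDeriv k i) x) hjk
  have R1 (x : S2) : rotDeriv k i (rotDeriv j k H) x
      = rotDeriv i j (fun y => -rotDeriv j k F y) x := by
    have h1 := rotDeriv_comm hH (coe_S2_ne_zero x) hjk hki hij.symm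
    have h2 := rotDeriv_comm hF (coe_S2_ne_zero x) hij hjk hki.symm
    rw [rotDeriv_swap i j] at h1
    rw [rotDeriv_swap k i] at h2
    rw [rotDeriv_neg]
    linarith [C1 x, C2 x, e1 x, e2 x]
  have R2 (x : S2) : rotDeriv i j (rotDeriv j k H) x
      = -rotDeriv k i (fun y => -rotDeriv j k F y) x := by
    have h1 := rotDeriv_comm hF (coe_S2_ne_zero x) hjk hki hij.symm
    have h2 := rotDeriv_comm hH (coe_S2_ne_zero x) hij hjk hki.symm
    rw [rotDeriv_swap i j] at h1
    rw [rotDeriv_swap k i] at h2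
    rw [rotDeriv_neg]
    linarith [C1 x, C2 x, e1 x, e2 x]
  have R3 (x : S2) : rotDeriv j k (fun y => -rotDeriv j k F y) x = rotDeriv j k H x := by
    rw [rotDeriv_neg, e4, neg_neg]
  -- Real part of the constant quotient; the rotated pair (K, −G) then gives its imaginary part c2.
  obtain ⟨c1, hc1⟩ := exists_const_quotient hG hK hp (fun x => by rw [e3, neg_neg]) R3 R1 R2
  obtain ⟨c2, hc2⟩ := exists_const_quotient hK hG.neg hp (fun x => by rw [R3, neg_neg])
    (fun x => by rw [rotDeriv_neg, e3])
    (fun x => by rw [rotDeriv_neg, rotDeriv_neg, R2, rotDeriv_neg, neg_neg])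
    (fun x => by rw [rotDeriv_neg, rotDeriv_neg, R1, rotDeriv_neg, neg_neg])
  have q1 (x : S2) (hx : (x : E3) j ^ 2 + (x : E3) k ^ 2 ≠ 0) :
      rotDeriv j k H x = c1 * (x : E3) j - c2 * (x : E3) k := by
    refine mul_right_cancel₀ hx ?_
    linear_combination (x : E3) j * hc1 x hx - (x : E3) k * hc2 x hx
  have q2 (x : S2) (hx : (x : E3) j ^ 2 + (x : E3) k ^ 2 ≠ 0) :
      rotDeriv j k F x = -(c1 * (x : E3) k + c2 * (x : E3) j) := by
    refine mul_right_cancel₀ hx ?_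
    linear_combination -(x : E3) k * hc1 x hx - (x : E3) j * hc2 x hx
  -- P and Q are the linear functions with L_i P and L_i Q equal to the values found in `q2` and
  -- `q1`; they also form a conjugate pair.
  let P : E3 → ℝ := fun y => c1 * y j - c2 * y k
  let Q : E3 → ℝ := fun y => c1 * y k + c2 * y j
  have hX1 (c : ℝ) (a : Fin 3) : SmoothOffZero (fun y => c * y a) := fun y _ => by fun_prop
  have hP : SmoothOffZero P := (hX1 c1 j).sub (hX1 c2 k)
  have hQ : SmoothOffZero Q := (hX1 c1 k).add (hX1 c2 j)
  have LP (a b : Fin 3) (x : S2) : rotDeriv a b (fun y => F y - P y) x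
      = rotDeriv a b F x - (c1 * rotDeriv a b (fun y => y j) x
        - c2 * rotDeriv a b (fun y => y k) x) := by
    rw [rotDeriv_sub (hd hF x) (hd hP x), rotDeriv_sub (hd (hX1 c1 j) x) (hd (hX1 c2 k) x),
      rotDeriv_const_mul, rotDeriv_const_mul]
  have LQ (a b : Fin 3) (x : S2) : rotDeriv a b (fun y => H y - Q y) x
      = rotDeriv a b H x - (c1 * rotDeriv a b (fun y => y k) x
        + c2 * rotDeriv a b (fun y => y j) x) := by
    rw [rotDeriv_sub (hd hH x) (hd hQ x), rotDeriv_add (hd (hX1 c1 k) x) (hd (hX1 c2 j) x),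
      rotDeriv_const_mul, rotDeriv_const_mul]
  have T1 (x : S2) (hx : (x : E3) j ^ 2 + (x : E3) k ^ 2 ≠ 0) :
      rotDeriv j k (fun y => F y - P y) x = 0 := by
    rw [LP, q2 x hx]
    simp only [rotDeriv_coordinate, hjk, hjk.symm, if_true, if_false]
    ring
  have T2 (x : S2) (hx : (x : E3) j ^ 2 + (x : E3) k ^ 2 ≠ 0) :
      rotDeriv j k (fun y => H y - Q y) x = 0 := by
    rw [LQ, q1 x hx]
    simp only [rotDeriv_coordinate, hjk, hjk.symm, if_true, if_false]
    ring
  have T3 (x : S2) : rotDeriv k i (fun y => F y - P y) x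
      = rotDeriv i j (fun y => H y - Q y) x := by
    rw [LP, LQ, e1]
    simp only [rotDeriv_coordinate, hjk, hki, hij.symm, hjk.symm, if_true, if_false]
    ring
  have T4 (x : S2) : rotDeriv i j (fun y => F y - P y) x
      = -rotDeriv k i (fun y => H y - Q y) x := by
    rw [LP, LQ, e2]
    simp only [rotDeriv_coordinate, hjk, hki, hij.symm, hjk.symm, if_true, if_false]
    ring
  obtain ⟨c, hc⟩ := exists_const_of_conjugate (hF.sub hP) hp T1 T2 T3 T4
  obtain ⟨c', hc'⟩ := exists_const_of_conjugate (hH.sub hQ) (H := fun y => -(F y - P y)) hp T2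
    (fun x hx => by rw [rotDeriv_neg, T1 x hx, neg_zero])
    (fun x => by rw [rotDeriv_neg, T4, neg_neg]) (fun x => by rw [rotDeriv_neg, T3, neg_neg])
  have hcoord (a : Fin 3) : Continuous (coord a) := (hX a).continuous
  refine ⟨c1, -c2, c, c', eq_of_eq_off_axis hf.continuous ?_ hp fun x hx => ?_,
    eq_of_eq_off_axis hh.continuous ?_ hp fun x hx => ?_⟩
  · have := hcoord j; have := hcoord k; fun_prop
  · rw [← hFf]
    simp only [coord]
    linear_combination hc x hx
  · have := hcoord j; have := hcoord k; fun_prop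
  · rw [← hHh]
    simp only [coord]
    linear_combination hc' x hx

/-- Both parts of the deficit vanish: the squares pointwise, and the circle integrand because it is
an L_i-derivative, namely that of −PQ − 2cQ. -/
theorem equality_of_eq {f h : S2 → ℝ} (hf : ContMDiff (𝓡 2) 𝓘(ℝ, ℝ) ∞ f)
    (hh : ContMDiff (𝓡 2) 𝓘(ℝ, ℝ) ∞ h) {i j k : Fin 3} (hp : IsPositivePerm i j k)
    {cj ck c c' : ℝ} (h1 : ∀ x, f x = cj * coord j x + ck * coord k x + c)
    (h2 : ∀ x, h x = -ck * coord j x + cj * coord k x + c') :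
    4 * crIntegral i f h = energy f + energy h := by
  obtain ⟨hij, hjk, hki⟩ := hp.ne
  have hd {L : E3 → ℝ} (hL : SmoothOffZero L) (x : S2) : DifferentiableAt ℝ L x :=
    hL.differentiableAt (coe_S2_ne_zero x)
  have hX (c : ℝ) (a : Fin 3) : SmoothOffZero (fun y => c * y a) := fun y _ => by fun_prop
  let P : E3 → ℝ := fun y => cj * y j + ck * y k
  let Q : E3 → ℝ := fun y => -ck * y j + cj * y k
  have hP : SmoothOffZero P := (hX cj j).add (hX ck k)
  have hQ : SmoothOffZero Q := (hX (-ck) j).add (hX cj k)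
  have hconst (c : ℝ) : SmoothOffZero (fun _ => c) := fun _ _ => contDiffAt_const
  have hL0 (a b : Fin 3) (c : ℝ) (x : S2) : rotDeriv a b (fun _ => c) x = 0 := by
    simp [rotDeriv]
  have LP {a b : Fin 3} (hab : a ≠ b) (x : S2) : rotDeriv a b (radialExt f) x
      = cj * rotDeriv a b (fun y => y j) x + ck * rotDeriv a b (fun y => y k) x := by
    rw [rotDeriv_congr (G := fun y => P y + c) (fun z => by rw [radialExt_coe, h1]; rfl)
      (hd (smoothOffZero_radialExt hf) x) (hd (hP.add (hconst c)) x) hab,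
      rotDeriv_add (hd hP x) (hd (hconst c) x), hL0, add_zero,
      rotDeriv_add (hd (hX cj j) x) (hd (hX ck k) x), rotDeriv_const_mul, rotDeriv_const_mul]
  have LQ {a b : Fin 3} (hab : a ≠ b) (x : S2) : rotDeriv a b (radialExt h) x
      = -ck * rotDeriv a b (fun y => y j) x + cj * rotDeriv a b (fun y => y k) x := by
    rw [rotDeriv_congr (G := fun y => Q y + c') (fun z => by rw [radialExt_coe, h2]; rfl)
      (hd (smoothOffZero_radialExt hh) x) (hd (hQ.add (hconst c')) x) hab,
      rotDeriv_add (hd hQ x) (hd (hconst c') x), hL0, add_zero,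
      rotDeriv_add (hd (hX (-ck) j) x) (hd (hX cj k) x), rotDeriv_const_mul, rotDeriv_const_mul]
  have LP' (x : S2) : rotDeriv j k P x = -Q x := by
    rw [rotDeriv_add (hd (hX cj j) x) (hd (hX ck k) x), rotDeriv_const_mul, rotDeriv_const_mul]
    simp only [rotDeriv_coordinate, hjk, hjk.symm, if_true, if_false, Q]
    ring
  have LQ' (x : S2) : rotDeriv j k Q x = P x := by
    rw [rotDeriv_add (hd (hX (-ck) j) x) (hd (hX cj k) x), rotDeriv_const_mul,
      rotDeriv_const_mul]
    simp only [rotDeriv_coordinate, hjk, hjk.symm, if_true, if_false, P]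
    ring
  have h3 := energy_add_energy_sub_crIntegral hf hh hp
  have h4 (x : S2) : (rotDeriv k i (radialExt f) x - rotDeriv i j (radialExt h) x) ^ 2
      + (rotDeriv i j (radialExt f) x + rotDeriv k i (radialExt h) x) ^ 2 = 0 := by
    rw [LP hki, LP hij, LQ hki, LQ hij]
    simp only [rotDeriv_coordinate, hjk, hki, hij.symm, hjk.symm, if_true, if_false]
    ring
  have h5 (x : S2) : rotDeriv j k (radialExt f) x ^ 2 + rotDeriv j k (radialExt h) x ^ 2
      - 2 * (f x * rotDeriv j k (radialExt h) x)
      = -rotDeriv j k (fun y => P y * Q y) x - 2 * c * rotDeriv j k Q x := by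
    rw [rotDeriv_mul (hd hP x) (hd hQ x), LP', LQ', LP hjk, LQ hjk, h1]
    simp only [rotDeriv_coordinate, hjk, hjk.symm, if_true, if_false, P, Q, coord]
    ring
  have h6 := integral_rotDeriv hjk (hP.mul hQ)
  have h7 := integral_rotDeriv hjk hQ
  simp only [h4, h5, integral_zero] at h3
  rw [integral_sub (integrable_area ((hP.mul hQ).rotDeriv j k).continuous.fun_neg)
    ((integrable_area (hQ.rotDeriv j k).continuous).const_mul _), integral_neg,
    integral_const_mul, h6, h7] at h3
  linarith

/-! ### From the sum of energies to the product of norms. -/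

theorem two_mul_crIntegral_le {f h : S2 → ℝ} (hf : ContMDiff (𝓡 2) 𝓘(ℝ, ℝ) ∞ f)
    (hh : ContMDiff (𝓡 2) 𝓘(ℝ, ℝ) ∞ h) (i : Fin 3) :
    2 * crIntegral i f h ≤ gradL2 f * gradL2 h := by
  rcases (gradL2_nonneg f).eq_or_lt with hA | hA
  · rw [crIntegral_eq_zero_of_isConst_left hf hh ((gradL2_eq_zero_iff hf).1 hA.symm), ← hA]
    simp
  rcases (gradL2_nonneg h).eq_or_lt with hB | hB
  · rw [crIntegral_eq_zero_of_isConst_right hf hh ((gradL2_eq_zero_iff hh).1 hB.symm), ← hB]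
    simp
  -- With these weights both functions have energy ‖∇f‖²‖∇h‖², so the arithmetic–geometric mean step
  -- loses nothing.
  have h1 := four_mul_crIntegral_le (contMDiff_const_mul (gradL2 h) hf)
    (contMDiff_const_mul (gradL2 f) hh) i
  rw [crIntegral_const_mul _ _ hf hh, energy_const_mul _ hf, energy_const_mul _ hh, ← gradL2_sq f,
    ← gradL2_sq h] at h1
  refine le_of_mul_le_mul_left ?_ (mul_pos hA hB)
  linarith

theorem eq_of_two_mul_crIntegral_eq {f h : S2 → ℝ} (hf : ContMDiff (𝓡 2) 𝓘(ℝ, ℝ) ∞ f)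
    (hh : ContMDiff (𝓡 2) 𝓘(ℝ, ℝ) ∞ h) {i j k : Fin 3} (hp : IsPositivePerm i j k)
    (he : 2 * crIntegral i f h = gradL2 f * gradL2 h) :
    IsConst f ∨ IsConst h ∨
      ∃ cj ck c c' : ℝ, 0 < gradL2 f ∧ 0 < gradL2 h ∧
        (∀ x, f x = cj * coord j x + ck * coord k x + c) ∧
        (∀ x, h x = gradL2 h / gradL2 f * (-ck * coord j x + cj * coord k x) + c') := by
  rcases (gradL2_nonneg f).eq_or_lt with hA | hA
  · exact Or.inl ((gradL2_eq_zero_iff hf).1 hA.symm)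
  rcases (gradL2_nonneg h).eq_or_lt with hB | hB
  · exact Or.inr (Or.inl ((gradL2_eq_zero_iff hh).1 hB.symm))
  right; right
  -- Equality passes to the rescaled pair; undoing the two weights produces the ratio ‖∇h‖/‖∇f‖.
  obtain ⟨cj, ck, c, c', h1, h2⟩ := eq_of_equality (contMDiff_const_mul (gradL2 h) hf)
    (contMDiff_const_mul (gradL2 f) hh) hp (by
      rw [crIntegral_const_mul _ _ hf hh, energy_const_mul _ hf, energy_const_mul _ hh,
        ← gradL2_sq f, ← gradL2_sq h]
      linear_combination 2 * gradL2 f * gradL2 h * he)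
  refine ⟨cj / gradL2 h, ck / gradL2 h, c / gradL2 h, c' / gradL2 f, hA, hB, fun x => ?_,
    fun x => ?_⟩
  · field_simp
    linear_combination h1 x
  · field_simp
    linear_combination h2 x

theorem two_mul_crIntegral_eq_of_isConst {f h : S2 → ℝ} (hf : ContMDiff (𝓡 2) 𝓘(ℝ, ℝ) ∞ f)
    (hh : ContMDiff (𝓡 2) 𝓘(ℝ, ℝ) ∞ h) (hc : IsConst f ∨ IsConst h) (i : Fin 3) :
    2 * crIntegral i f h = gradL2 f * gradL2 h := by
  rcases hc with hc | hc
  · rw [crIntegral_eq_zero_of_isConst_left hf hh hc, (gradL2_eq_zero_iff hf).2 hc]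
    simp
  · rw [crIntegral_eq_zero_of_isConst_right hf hh hc, (gradL2_eq_zero_iff hh).2 hc]
    simp

theorem two_mul_crIntegral_eq_of_eq {f h : S2 → ℝ} (hf : ContMDiff (𝓡 2) 𝓘(ℝ, ℝ) ∞ f)
    (hh : ContMDiff (𝓡 2) 𝓘(ℝ, ℝ) ∞ h) {i j k : Fin 3} (hp : IsPositivePerm i j k)
    {r cj ck c c' : ℝ} (hr : 0 < r) (h1 : ∀ x, f x = cj * coord j x + ck * coord k x + c)
    (h2 : ∀ x, h x = r * (-ck * coord j x + cj * coord k x) + c') :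
    2 * crIntegral i f h = gradL2 f * gradL2 h := by
  have hg := contMDiff_const_mul r⁻¹ hh
  have h3 := equality_of_eq hf hg hp h1 (c' := r⁻¹ * c') (fun x => by
    rw [h2]
    field_simp)
  have h4 := two_mul_crIntegral_le hf hg i
  have h5 := crIntegral_const_mul 1 r⁻¹ hf hh i
  simp only [one_mul] at h5
  rw [← gradL2_sq, ← gradL2_sq, h5, gradL2_const_mul (inv_pos.2 hr).le hh] at h3
  rw [h5, gradL2_const_mul (inv_pos.2 hr).le hh] at h4
  -- Equality with the sum of squares and the bound by the product together force the two norms to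
  -- agree.
  have h6 : (gradL2 f - r⁻¹ * gradL2 h) ^ 2 = 0 := le_antisymm (by linarith) (sq_nonneg _)
  refine mul_left_cancel₀ (inv_pos.2 hr).ne' ?_
  linear_combination h3 / 2 + h6 / 2

end CauchyRiemannSphere

end


open CauchyRiemannSphere in
theorem theorem1p1 (f h : S2 → ℝ)
    (hf : ContMDiff (𝓡 2) 𝓘(ℝ, ℝ) ∞ f) (hh : ContMDiff (𝓡 2) 𝓘(ℝ, ℝ) ∞ h) :
    -- the short integral Cauchy-Riemann inequality
    (∀ i : Fin 3, 2 * crIntegral i f h ≤ gradL2 f * gradL2 h) ∧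
    -- the case of equality
    (∀ i j k : Fin 3, IsPositivePerm i j k →
      (2 * crIntegral i f h = gradL2 f * gradL2 h ↔
        IsConst f ∨ IsConst h ∨
          ∃ r cj ck c c' : ℝ, 0 < r ∧
            (∀ x, f x = cj * coord j x + ck * coord k x + c) ∧
            (∀ x, h x = r * (-ck * coord j x + cj * coord k x) + c'))) ∧
    -- the case of equality under the normalisation of equal energies, where the factor is 1
    (gradL2 f = gradL2 h → ∀ i j k : Fin 3, IsPositivePerm i j k →
      (2 * crIntegral i f h = gradL2 f * gradL2 h ↔
        IsConst f ∨ IsConst h ∨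
          ∃ cj ck c c' : ℝ,
            (∀ x, f x = cj * coord j x + ck * coord k x + c) ∧
            (∀ x, h x = -ck * coord j x + cj * coord k x + c'))) := by
  refine ⟨two_mul_crIntegral_le hf hh, fun i j k hp => ?_, fun hfh i j k hp => ?_⟩
  · constructor
    · intro he
      rcases eq_of_two_mul_crIntegral_eq hf hh hp he with
        hc | hc | ⟨cj, ck, c, c', hA, hB, h1, h2⟩
      · exact Or.inl hc
      · exact Or.inr (Or.inl hc)
      · exact Or.inr (Or.inr ⟨_, cj, ck, c, c', div_pos hB hA, h1, h2⟩)
    · rintro (hc | hc | ⟨r, cj, ck, c, c', hr, h1, h2⟩)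
      · exact two_mul_crIntegral_eq_of_isConst hf hh (Or.inl hc) i
      · exact two_mul_crIntegral_eq_of_isConst hf hh (Or.inr hc) i
      · exact two_mul_crIntegral_eq_of_eq hf hh hp hr h1 h2
  · constructor
    · intro he
      rcases eq_of_two_mul_crIntegral_eq hf hh hp he with
        hc | hc | ⟨cj, ck, c, c', hA, hB, h1, h2⟩
      · exact Or.inl hc
      · exact Or.inr (Or.inl hc)
      · rw [hfh, div_self hB.ne'] at h2
        exact Or.inr (Or.inr ⟨cj, ck, c, c', h1, by simpa only [one_mul] using h2⟩)
    · rintro (hc | hc | ⟨cj, ck, c, c', h1, h2⟩)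
      · exact two_mul_crIntegral_eq_of_isConst hf hh (Or.inl hc) i
      · exact two_mul_crIntegral_eq_of_isConst hf hh (Or.inr hc) i
      · exact two_mul_crIntegral_eq_of_eq hf hh hp one_pos h1 (by simpa only [one_mul] using h2)
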